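/- Let $(\bar M,\bar g,\bar J)$ be a locally bronze semi-Riemannian manifold: $\bar g$ is a semi-Riemannian metric of constant index $q$, $1\le q\le \dim\bar M-1$, with Levi-Civita connection $\bar\nabla$, and $\bar J$ is a smooth $(1,1)$-tensor field with $\bar J^2=3\bar J+I$, $\bar g(X,\bar JY)=\bar g(\bar JX,Y)$ and $\bar\nabla\bar J=0$. Let $l,m$ be smooth functions on $\bar M$, not both identically zero, let $\eta$ be a smooth unit spacelike vector field and $\theta(X)=\bar g(X,\eta)$, and let $\bar\Omega$ be the $(l,m)$-type connection $$\bar\Omega_XY=\bar\nabla_XY+\theta(Y)\{lX+m\bar JX\}.$$ Let $(M,g,S(TM),S(TM^\perp))$ be an $r$-lightlike submanifold of $\bar M$, $r>0$: $\mathrm{Rad}\,TM=TM\cap TM^\perp$ is a smooth distribution of rank $r$, and $S(TM)$, $S(TM^\perp)$ are smooth subbundles with $TM=\mathrm{Rad}\,TM\perp S(TM)$ and $TM^\perp=\mathrm{Rad}\,TM\perp S(TM^\perp)$. Let $ltr(TM)$ be a lightlike transversal bundle: a smooth totally null bundle complementary to $\mathrm{Rad}\,TM$ in the bundle of vectors orthogonal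 to $S(TM)$ and $S(TM^\perp)$. Put $tr(TM)=ltr(TM)\perp S(TM^\perp)$, so that $T\bar M|_M=TM\oplus tr(TM)$. Assume that $M$ is screen generic: $\bar J(\mathrm{Rad}\,TM)=\mathrm{Rad}\,TM$, $\bar J(ltr(TM))=ltr(TM)$, and $B_o=\bar J(S(TM))\cap S(TM)$ is a smooth non-degenerate distribution. Let $B'$ be the orthogonal complement of $B_o$ in $S(TM)$. For $Z\in\Gamma(TM)$ let $fZ$ and $wZ$ be the tangential and the transversal part of $\bar JZ$. For $X,Y\in\Gamma(TM)$ let $\Omega_XY$ be the tangential part of $\bar\Omega_XY$; for $Y\in\Gamma(S(TM))$ write $\Omega_XY=\Omega^*_XY+\bar h^*(X,Y)$ with $\Omega^*_XY\in\Gamma(S(TM))$ and $\bar h^*(X,Y)\in\Gamma(\mathrm{Rad}\,TM)$; for a section $W$ of $tr(TM)$ let $-\bar A_WX$ be the tangential part of $\bar\Omega_XW$. Then the distribution $B'$ is parallel, that is $\Omega_YZ\in\Gamma(B')$ for all $Y,Z\in\Gamma(B')$, if and only if (i) $\bar g(\bar h^*(Y,fZ),\bar JN)+3\bar g(\bar A_{wZ}Y,N)=3\bar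 g(\bar h^*(Y,fZ),N)+\bar g(\bar A_{wZ}Y,\bar JN)$, and (ii) $\bar g(\Omega^*_YfZ,\bar JX)+3\bar g(\bar A_{wZ}Y,X)=\bar g(\bar A_{wZ}Y,\bar JX)+3\bar g(\Omega^*_YfZ,X)$ hold for all $Y,Z\in\Gamma(B')$, $X\in\Gamma(B_o)$ and $N\in\Gamma(ltr(TM))$. -/

import Mathlib

open scoped Manifold ContDiff

noncomputable section

namespace BronzeLightlike

/-! ### Linear algebra -/

/-- The bilinear form `b` has (negative) index `q`: the largest dimension of a subspace on which
it is negative definite is `q`. -/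
def HasIndex {V : Type*} [AddCommGroup V] [Module ℝ V] (b : LinearMap.BilinForm ℝ V) (q : ℕ) :
    Prop :=
  IsGreatest {k : ℕ | ∃ W : Submodule ℝ V, Module.finrank ℝ W = k ∧
    ∀ v ∈ W, v ≠ 0 → b v v < 0} q

/-- Let `R = T ⊓ Tᗮ` be the radical of `T`, let `S`, `K` be complements of `R` in `T` and in `Tᗮ`,
and `L` a complement of `R` in `(S ⊔ K)ᗮ`. Then `L ⊔ K` is a complement of `T`. -/
theorem isCompl_transversal {V : Type*} [AddCommGroup V] [Module ℝ V] [FiniteDimensional ℝ V]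
    (B : LinearMap.BilinForm ℝ V) (hs : ∀ x y, B x y = B y x) (hB : B.Nondegenerate)
    (T S K L : Submodule ℝ V)
    (hS : (T ⊓ B.orthogonal T) ⊔ S = T) (hS0 : (T ⊓ B.orthogonal T) ⊓ S = ⊥)
    (hK : (T ⊓ B.orthogonal T) ⊔ K = B.orthogonal T) (hK0 : (T ⊓ B.orthogonal T) ⊓ K = ⊥)
    (hL : (T ⊓ B.orthogonal T) ⊔ L = B.orthogonal S ⊓ B.orthogonal K)
    (hL0 : (T ⊓ B.orthogonal T) ⊓ L = ⊥) :
    IsCompl T (L ⊔ K) := by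
  have hrefl : B.IsRefl := fun x y h => by rw [hs]; exact h
  have hTT : B.orthogonal (B.orthogonal T) = T :=
    LinearMap.BilinForm.orthogonal_orthogonal hB hrefl T
  set R := T ⊓ B.orthogonal T with hR
  have hST : S ≤ T := hS ▸ le_sup_right
  have hKT : K ≤ B.orthogonal T := hK ▸ le_sup_right
  have hRT : R ≤ T := inf_le_left
  have hRT' : R ≤ B.orthogonal T := inf_le_right
  have hTo : ∀ x ∈ T, ∀ y ∈ B.orthogonal T, B x y = 0 := fun x hx y hy => hy x hx
  have hLS : ∀ n ∈ L, ∀ s ∈ S, B s n = 0 := fun n hn s h =>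
    ((hL ▸ (le_sup_right : L ≤ R ⊔ L)) hn).1 s h
  have hLK : ∀ n ∈ L, ∀ w ∈ K, B w n = 0 := fun n hn w h =>
    ((hL ▸ (le_sup_right : L ≤ R ⊔ L)) hn).2 w h
  -- the screens are nondegenerate
  have hSnd : ∀ s ∈ S, (∀ s' ∈ S, B s' s = 0) → s = 0 := by
    intro s h h0
    have : s ∈ R ⊓ S := by
      refine ⟨⟨hST h, ?_⟩, h⟩
      intro t ht
      rw [← hS] at ht
      obtain ⟨ξ, hξ, s', hs', rfl⟩ := Submodule.mem_sup.1 ht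
      change B (ξ + s') s = 0
      rw [map_add, LinearMap.add_apply, h0 s' hs', hs ξ s, hTo s (hST h) ξ (hRT' hξ), add_zero]
    rw [hS0] at this
    exact this
  have hKnd : ∀ w ∈ K, (∀ w' ∈ K, B w' w = 0) → w = 0 := by
    intro w h h0
    have : w ∈ R ⊓ K := by
      refine ⟨⟨?_, hKT h⟩, h⟩
      rw [← hTT]
      intro t ht
      rw [← hK] at ht
      obtain ⟨ξ, hξ, w', hw', rfl⟩ := Submodule.mem_sup.1 ht
      change B (ξ + w') w = 0
      rw [map_add, LinearMap.add_apply, h0 w' hw', hTo ξ (hRT hξ) w (hKT h), add_zero]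
    rw [hK0] at this
    exact this
  have hdisj : ∀ x ∈ T, x ∈ L ⊔ K → x = 0 := by
    intro x hx hx'
    obtain ⟨n, hn, w, hw, rfl⟩ := Submodule.mem_sup.1 hx'
    rw [← hS] at hx
    obtain ⟨ξ, hξ, s, h, hxs⟩ := Submodule.mem_sup.1 hx
    have s0 : s = 0 := by
      refine hSnd s h fun s' hs' => ?_
      have h1 : B s' (ξ + s) = B s' (n + w) := by rw [hxs]
      rw [map_add, map_add, hTo s' (hST hs') ξ (hRT' hξ), hLS n hn s' hs',
        hTo s' (hST hs') w (hKT hw)] at h1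
      simpa using h1
    rw [s0, add_zero] at hxs
    have w0 : w = 0 := by
      refine hKnd w hw fun w' hw' => ?_
      have h1 : B w' ξ = B w' (n + w) := by rw [hxs]
      rw [map_add, hs w' ξ, hTo ξ (hRT hξ) w' (hKT hw'), hLK n hn w' hw'] at h1
      simpa using h1.symm
    rw [w0, add_zero] at hxs ⊢
    have : n ∈ R ⊓ L := ⟨hxs ▸ hξ, hn⟩
    rw [hL0] at this
    exact this
  have horth : B.orthogonal (T ⊔ (L ⊔ K)) = ⊥ := by
    rw [eq_bot_iff]
    intro v hv
    have hvT : v ∈ B.orthogonal T := fun t ht => hv t (Submodule.mem_sup_left ht)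
    have hvL : ∀ n ∈ L, B n v = 0 := fun n hn =>
      hv n (Submodule.mem_sup_right (Submodule.mem_sup_left hn))
    have hvK : ∀ w ∈ K, B w v = 0 := fun w hw =>
      hv w (Submodule.mem_sup_right (Submodule.mem_sup_right hw))
    have hv' := hvT
    rw [← hK] at hv'
    obtain ⟨ξ, hξ, w, hw, rfl⟩ := Submodule.mem_sup.1 hv'
    have w0 : w = 0 := by
      refine hKnd w hw fun w' hw' => ?_
      have h1 := hvK w' hw'
      rw [map_add, hs w' ξ, hTo ξ (hRT hξ) w' (hKT hw')] at h1
      simpa using h1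
    rw [w0, add_zero] at hvL ⊢
    -- `ξ` is orthogonal to `(S ⊔ K)ᗮ`, hence lies in `S ⊔ K`
    have hξSK : ξ ∈ S ⊔ K := by
      rw [← LinearMap.BilinForm.orthogonal_orthogonal hB hrefl (S ⊔ K)]
      intro z hz
      have hz' : z ∈ B.orthogonal S ⊓ B.orthogonal K :=
        ⟨fun s h => hz s (Submodule.mem_sup_left h), fun w h => hz w (Submodule.mem_sup_right h)⟩
      rw [← hL] at hz'
      obtain ⟨ζ, hζ, n, hn, rfl⟩ := Submodule.mem_sup.1 hz'
      change B (ζ + n) ξ = 0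
      rw [map_add, LinearMap.add_apply, hTo ζ (hRT hζ) ξ (hRT' hξ), hvL n hn, add_zero]
    obtain ⟨s, h, w', hw', hsw⟩ := Submodule.mem_sup.1 hξSK
    have s0 : s = 0 := by
      refine hSnd s h fun s' hs' => ?_
      have h1 : B s' (s + w') = B s' ξ := by rw [hsw]
      rw [map_add, hTo s' (hST hs') w' (hKT hw'), hTo s' (hST hs') ξ (hRT' hξ)] at h1
      simpa using h1
    rw [s0, zero_add] at hsw
    have : ξ ∈ R ⊓ K := ⟨hξ, hsw ▸ hw'⟩
    rw [hK0] at this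
    exact this
  refine ⟨?_, ?_⟩
  · rw [Submodule.disjoint_def]
    exact hdisj
  · rw [codisjoint_iff, ← LinearMap.BilinForm.orthogonal_orthogonal hB hrefl (T ⊔ (L ⊔ K)), horth]
    rw [eq_top_iff]
    intro v _ z hz
    rw [(Submodule.mem_bot ℝ).1 hz]
    change B 0 v = 0
    simp

/-! ### The ambient manifold -/

section Ambient

variable (E : Type*) [NormedAddCommGroup E] [NormedSpace ℝ E] [FiniteDimensional ℝ E]
  (Q : Type*) [TopologicalSpace Q] [ChartedSpace E Q] [IsManifold 𝓘(ℝ, E) ∞ Q]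

/-- A semi-Riemannian metric on the manifold `Q`: a smooth field of symmetric nondegenerate
bilinear forms of constant index `q`, with `1 ≤ q ≤ dim Q - 1`. -/
structure SemiRiemannianMetric where
  toFun : ∀ x : Q, TangentSpace 𝓘(ℝ, E) x →L[ℝ] TangentSpace 𝓘(ℝ, E) x →L[ℝ] ℝ
  symm : ∀ x v w, toFun x v w = toFun x w v
  nondegenerate : ∀ x v, (∀ w, toFun x v w = 0) → v = 0
  smooth : ContMDiff 𝓘(ℝ, E) (𝓘(ℝ, E).prod 𝓘(ℝ, E →L[ℝ] E →L[ℝ] ℝ)) ∞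
    (fun x => Bundle.TotalSpace.mk' (E →L[ℝ] E →L[ℝ] ℝ)
      (E := fun x : Q => TangentSpace 𝓘(ℝ, E) x →L[ℝ] TangentSpace 𝓘(ℝ, E) x →L[ℝ] ℝ) x (toFun x))
  index : ℕ
  hasIndex : ∀ x, HasIndex
    (LinearMap.mk₂ ℝ (fun v w : TangentSpace 𝓘(ℝ, E) x => toFun x v w)
      (by simp) (by simp) (by simp) (by simp)) index
  one_le_index : 1 ≤ index
  index_lt : index + 1 ≤ Module.finrank ℝ E

variable {E Q}

/-- The metric at a point as a bilinear form. -/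
def SemiRiemannianMetric.form (g : SemiRiemannianMetric E Q) (x : Q) :
    LinearMap.BilinForm ℝ (TangentSpace 𝓘(ℝ, E) x) :=
  LinearMap.mk₂ ℝ (fun v w => g.toFun x v w) (by simp) (by simp) (by simp) (by simp)

/-- `V` is a smooth section along `φ` of the tangent bundle of the target of `φ`. With `φ = id`
these are the smooth vector fields. -/
def SmoothAlong (F : Type*) [NormedAddCommGroup F] [NormedSpace ℝ F]
    {M : Type*} [TopologicalSpace M] [ChartedSpace F M]
    (φ : M → Q) (V : ∀ p : M, TangentSpace 𝓘(ℝ, E) (φ p)) (s : Set M) : Prop :=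
  ContMDiffOn 𝓘(ℝ, F) (𝓘(ℝ, E).prod 𝓘(ℝ, E)) ∞
    (fun p => (⟨φ p, V p⟩ : TangentBundle 𝓘(ℝ, E) Q)) s

/-- The family `D` of subspaces of the tangent spaces along `φ` is a smooth vector subbundle:
locally it is spanned by a smooth frame. -/
def IsSmoothSubbundle (F : Type*) [NormedAddCommGroup F] [NormedSpace ℝ F]
    {M : Type*} [TopologicalSpace M] [ChartedSpace F M]
    (φ : M → Q) (D : ∀ p : M, Submodule ℝ (TangentSpace 𝓘(ℝ, E) (φ p))) : Prop :=
  ∀ p₀ : M, ∃ U : Set M, IsOpen U ∧ p₀ ∈ U ∧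
    ∃ (k : ℕ) (s : Fin k → ∀ p : M, TangentSpace 𝓘(ℝ, E) (φ p)),
      (∀ i, SmoothAlong F φ (s i) U) ∧
      ∀ p ∈ U, LinearIndependent ℝ (fun i => s i p) ∧
        Submodule.span ℝ (Set.range fun i => s i p) = D p

/-- `V ∈ Γ(D)`: `V` is a smooth (global) section of the family of subspaces `D` along `φ`. -/
def IsSection (F : Type*) [NormedAddCommGroup F] [NormedSpace ℝ F]
    {M : Type*} [TopologicalSpace M] [ChartedSpace F M]
    (φ : M → Q) (D : ∀ p : M, Submodule ℝ (TangentSpace 𝓘(ℝ, E) (φ p)))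
    (V : ∀ p : M, TangentSpace 𝓘(ℝ, E) (φ p)) : Prop :=
  SmoothAlong F φ V Set.univ ∧ ∀ p, V p ∈ D p

/-- `nabla` is the Levi-Civita connection of `g`: the torsion-free connection that is compatible
with `g`. -/
structure IsLeviCivita (g : SemiRiemannianMetric E Q)
    (nabla : CovariantDerivative 𝓘(ℝ, E) E (TangentSpace 𝓘(ℝ, E) : Q → Type _)) : Prop where
  torsion_free : ∀ (V W : ∀ x : Q, TangentSpace 𝓘(ℝ, E) x) (x : Q),
    MDifferentiableAt 𝓘(ℝ, E) (𝓘(ℝ, E).prod 𝓘(ℝ, E))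
      (fun y => (⟨y, V y⟩ : TangentBundle 𝓘(ℝ, E) Q)) x →
    MDifferentiableAt 𝓘(ℝ, E) (𝓘(ℝ, E).prod 𝓘(ℝ, E))
      (fun y => (⟨y, W y⟩ : TangentBundle 𝓘(ℝ, E) Q)) x →
    nabla W x (V x) - nabla V x (W x) = VectorField.mlieBracket 𝓘(ℝ, E) V W x
  metric : ∀ (V W : ∀ x : Q, TangentSpace 𝓘(ℝ, E) x) (x : Q) (u : TangentSpace 𝓘(ℝ, E) x),
    MDifferentiableAt 𝓘(ℝ, E) (𝓘(ℝ, E).prod 𝓘(ℝ, E))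
      (fun y => (⟨y, V y⟩ : TangentBundle 𝓘(ℝ, E) Q)) x →
    MDifferentiableAt 𝓘(ℝ, E) (𝓘(ℝ, E).prod 𝓘(ℝ, E))
      (fun y => (⟨y, W y⟩ : TangentBundle 𝓘(ℝ, E) Q)) x →
    mvfderiv 𝓘(ℝ, E) (fun y => g.toFun y (V y) (W y)) x u =
      g.toFun x (nabla V x u) (W x) + g.toFun x (V x) (nabla W x u)

/-- A bronze semi-Riemannian structure: a smooth `(1,1)`-tensor field `J` with `J² = 3J + I` which
is self-adjoint with respect to `g`. -/
structure BronzeStructure (g : SemiRiemannianMetric E Q) where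
  J : ∀ x : Q, TangentSpace 𝓘(ℝ, E) x →L[ℝ] TangentSpace 𝓘(ℝ, E) x
  smooth : ContMDiff 𝓘(ℝ, E) (𝓘(ℝ, E).prod 𝓘(ℝ, E →L[ℝ] E)) ∞
    (fun x => Bundle.TotalSpace.mk' (E →L[ℝ] E)
      (E := fun x : Q => TangentSpace 𝓘(ℝ, E) x →L[ℝ] TangentSpace 𝓘(ℝ, E) x) x (J x))
  sq : ∀ x v, J x (J x v) = (3 : ℝ) • J x v + v
  compatible : ∀ x v w, g.toFun x v (J x w) = g.toFun x (J x v) w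

/-- `∇ J = 0`, that is `∇_X (J V) = J (∇_X V)`: the bronze structure is locally bronze. -/
def BronzeStructure.IsParallelTensor {g : SemiRiemannianMetric E Q} (S : BronzeStructure g)
    (nabla : CovariantDerivative 𝓘(ℝ, E) E (TangentSpace 𝓘(ℝ, E) : Q → Type _)) : Prop :=
  ∀ (V : ∀ x : Q, TangentSpace 𝓘(ℝ, E) x) (x : Q) (u : TangentSpace 𝓘(ℝ, E) x),
    MDifferentiableAt 𝓘(ℝ, E) (𝓘(ℝ, E).prod 𝓘(ℝ, E))
      (fun y => (⟨y, V y⟩ : TangentBundle 𝓘(ℝ, E) Q)) x →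
    nabla (fun y => S.J y (V y)) x u = S.J x (nabla V x u)

/-- The data `(l, m, η)` of an `(l,m)`-type connection: smooth functions `l`, `m`, not both
identically zero, and a smooth unit spacelike vector field `η`. -/
structure LMData (g : SemiRiemannianMetric E Q) where
  l : Q → ℝ
  m : Q → ℝ
  η : ∀ x : Q, TangentSpace 𝓘(ℝ, E) x
  l_smooth : ContMDiff 𝓘(ℝ, E) 𝓘(ℝ, ℝ) ∞ l
  m_smooth : ContMDiff 𝓘(ℝ, E) 𝓘(ℝ, ℝ) ∞ m
  η_smooth : ContMDiff 𝓘(ℝ, E) (𝓘(ℝ, E).prod 𝓘(ℝ, E)) ∞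
    (fun x => (⟨x, η x⟩ : TangentBundle 𝓘(ℝ, E) Q))
  η_unit : ∀ x, g.toFun x (η x) (η x) = 1
  nontrivial : ¬ (l = 0 ∧ m = 0)

/-- The `1`-form `θ(X) = g(X, η)`. -/
def LMData.θ {g : SemiRiemannianMetric E Q} (D : LMData g) (x : Q) :
    TangentSpace 𝓘(ℝ, E) x →L[ℝ] ℝ :=
  g.toFun x (D.η x)

/-- The `(l,m)`-type connection `Ω̄_X Y = ∇_X Y + θ(Y) (l X + m J X)`. (In Mathlib's notation
`cov Y x u` is the derivative of `Y` at `x` in the direction `u`.) -/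
def lmConnection {g : SemiRiemannianMetric E Q}
    (nabla : CovariantDerivative 𝓘(ℝ, E) E (TangentSpace 𝓘(ℝ, E) : Q → Type _))
    (S : BronzeStructure g) (D : LMData g) :
    CovariantDerivative 𝓘(ℝ, E) E (TangentSpace 𝓘(ℝ, E) : Q → Type _) :=
  nabla.addOneForm fun x =>
    (D.θ x).smulRight (D.l x • ContinuousLinearMap.id ℝ (TangentSpace 𝓘(ℝ, E) x) + D.m x • S.J x)

end Ambient

/-! ### Sections along a map and lightlike submanifolds -/

section Submanifold

variable {E : Type*} [NormedAddCommGroup E] [NormedSpace ℝ E] [FiniteDimensional ℝ E]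
  {Q : Type*} [TopologicalSpace Q] [ChartedSpace E Q] [IsManifold 𝓘(ℝ, E) ∞ Q]
  {F : Type*} [NormedAddCommGroup F] [NormedSpace ℝ F] [FiniteDimensional ℝ F]
  {M : Type*} [TopologicalSpace M] [ChartedSpace F M] [IsManifold 𝓘(ℝ, F) ∞ M]

/-- The derivative `D_u V` at `p`, in the direction `u ∈ T_p M`, of a section `V` along `φ : M → Q`
with respect to the pull-back to `M` of the connection `D` of `Q`. In the trivialization of `TQ`
at `φ p`, with coordinate fields `e_k` and `V = ∑ Vᵏ e_k`, it is
`∑ (u Vᵏ) e_k + ∑ Vᵏ D_{φ_* u} e_k`. -/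
def covAlong (D : CovariantDerivative 𝓘(ℝ, E) E (TangentSpace 𝓘(ℝ, E) : Q → Type _))
    (φ : M → Q) (V : ∀ p : M, TangentSpace 𝓘(ℝ, E) (φ p)) (p : M)
    (u : TangentSpace 𝓘(ℝ, F) p) : TangentSpace 𝓘(ℝ, E) (φ p) :=
  let e := trivializationAt E (TangentSpace 𝓘(ℝ, E) : Q → Type _) (φ p)
  let v : M → E := fun y => (e ⟨φ y, V y⟩).2
  e.symmL ℝ (φ p) (mvfderiv 𝓘(ℝ, F) v p u) +
    D (fun x => e.symmL ℝ x (v p)) (φ p) (mfderiv 𝓘(ℝ, F) 𝓘(ℝ, E) φ p u)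

/-- The tangent space of the immersed submanifold `φ : M → Q` at `p`, as a subspace of
`T_{φ p} Q`. -/
def tangentImage (F : Type*) [NormedAddCommGroup F] [NormedSpace ℝ F]
    {M : Type*} [TopologicalSpace M] [ChartedSpace F M] (φ : M → Q) (p : M) : Submodule ℝ (TangentSpace 𝓘(ℝ, E) (φ p)) :=
  LinearMap.range (mfderiv 𝓘(ℝ, F) 𝓘(ℝ, E) φ p).toLinearMap

/-- `T_p M^⊥`. -/
def normalSpace (F : Type*) [NormedAddCommGroup F] [NormedSpace ℝ F]
    {M : Type*} [TopologicalSpace M] [ChartedSpace F M] (g : SemiRiemannianMetric E Q) (φ : M → Q) (p : M) :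
    Submodule ℝ (TangentSpace 𝓘(ℝ, E) (φ p)) :=
  (g.form (φ p)).orthogonal (tangentImage F φ p)

/-- `Rad T_p M = T_p M ∩ T_p M^⊥`, as a subspace of `T_p M`. -/
def radical (F : Type*) [NormedAddCommGroup F] [NormedSpace ℝ F]
    {M : Type*} [TopologicalSpace M] [ChartedSpace F M] (g : SemiRiemannianMetric E Q) (φ : M → Q) (p : M) :
    Submodule ℝ (TangentSpace 𝓘(ℝ, F) p) :=
  (normalSpace F g φ p).comap (mfderiv 𝓘(ℝ, F) 𝓘(ℝ, E) φ p).toLinearMap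

/-- An `r`-lightlike (immersed) submanifold `(M, g, S(TM), S(TM^⊥))` of `(Q, g)`, together with a
lightlike transversal bundle `ltr(TM)`. -/
structure LightlikeSubmanifold (F : Type*) [NormedAddCommGroup F] [NormedSpace ℝ F]
    [FiniteDimensional ℝ F] {M : Type*} [TopologicalSpace M] [ChartedSpace F M]
    [IsManifold 𝓘(ℝ, F) ∞ M]
    (g : SemiRiemannianMetric E Q) (φ : M → Q) (r : ℕ) where
  /-- `φ` is an immersion. -/
  smooth : ContMDiff 𝓘(ℝ, F) 𝓘(ℝ, E) ∞ φ
  injective : ∀ p, Function.Injective (mfderiv 𝓘(ℝ, F) 𝓘(ℝ, E) φ p)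
  /-- `Rad TM` is a smooth distribution of rank `r > 0`. -/
  r_pos : 0 < r
  rad_smooth : IsSmoothSubbundle F id (radical F g φ)
  rad_rank : ∀ p, Module.finrank ℝ (radical F g φ p) = r
  /-- `S(TM)`, a smooth distribution on `M` with `TM = Rad TM ⊥ S(TM)`. -/
  screen : ∀ p : M, Submodule ℝ (TangentSpace 𝓘(ℝ, F) p)
  screen_smooth : IsSmoothSubbundle F id screen
  isCompl_rad_screen : ∀ p, IsCompl (radical F g φ p) (screen p)
  /-- `S(TM^⊥)`, a smooth bundle with `TM^⊥ = Rad TM ⊥ S(TM^⊥)`. -/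
  screenTr : ∀ p : M, Submodule ℝ (TangentSpace 𝓘(ℝ, E) (φ p))
  screenTr_smooth : IsSmoothSubbundle F φ screenTr
  rad_sup_screenTr : ∀ p, (tangentImage F φ p ⊓ normalSpace F g φ p) ⊔ screenTr p =
    normalSpace F g φ p
  rad_inf_screenTr : ∀ p, (tangentImage F φ p ⊓ normalSpace F g φ p) ⊓ screenTr p = ⊥
  /-- `ltr(TM)`, a smooth totally null bundle which is complementary to `Rad TM` in the bundle of
  vectors orthogonal to `S(TM)` and to `S(TM^⊥)`. -/
  ltr : ∀ p : M, Submodule ℝ (TangentSpace 𝓘(ℝ, E) (φ p))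
  ltr_smooth : IsSmoothSubbundle F φ ltr
  ltr_null : ∀ p, ∀ v ∈ ltr p, ∀ w ∈ ltr p, g.toFun (φ p) v w = 0
  rad_sup_ltr : ∀ p, (tangentImage F φ p ⊓ normalSpace F g φ p) ⊔ ltr p =
    (g.form (φ p)).orthogonal ((screen p).map (mfderiv 𝓘(ℝ, F) 𝓘(ℝ, E) φ p).toLinearMap) ⊓
      (g.form (φ p)).orthogonal (screenTr p)
  rad_inf_ltr : ∀ p, (tangentImage F φ p ⊓ normalSpace F g φ p) ⊓ ltr p = ⊥

namespace LightlikeSubmanifold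

variable {g : SemiRiemannianMetric E Q} {φ : M → Q} {r : ℕ} (L : LightlikeSubmanifold F g φ r)

/-- `tr(TM) = ltr(TM) ⊥ S(TM^⊥)`. -/
def tr (p : M) : Submodule ℝ (TangentSpace 𝓘(ℝ, E) (φ p)) := L.ltr p ⊔ L.screenTr p

/-- `TQ|_M = TM ⊕ tr(TM)`. -/
theorem isCompl_tangent_tr (p : M) : IsCompl (tangentImage F φ p) (L.tr p) := by
  have : FiniteDimensional ℝ (TangentSpace 𝓘(ℝ, E) (φ p)) := inferInstanceAs (FiniteDimensional ℝ E)
  have hR : (radical F g φ p).map (mfderiv 𝓘(ℝ, F) 𝓘(ℝ, E) φ p).toLinearMap =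
      tangentImage F φ p ⊓ normalSpace F g φ p := Submodule.map_comap_eq _ _
  have hT : (⊤ : Submodule ℝ (TangentSpace 𝓘(ℝ, F) p)).map
      (mfderiv 𝓘(ℝ, F) 𝓘(ℝ, E) φ p).toLinearMap = tangentImage F φ p := Submodule.map_top _
  refine isCompl_transversal (g.form (φ p)) (g.symm (φ p)) ?_ (tangentImage F φ p)
    ((L.screen p).map (mfderiv 𝓘(ℝ, F) 𝓘(ℝ, E) φ p).toLinearMap) (L.screenTr p) (L.ltr p)
    ?_ ?_ (L.rad_sup_screenTr p) (L.rad_inf_screenTr p) (L.rad_sup_ltr p) (L.rad_inf_ltr p)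
  · refine ⟨fun x h => g.nondegenerate _ x h, fun x h => g.nondegenerate _ x fun w => ?_⟩
    rw [g.symm]
    exact h w
  · change tangentImage F φ p ⊓ normalSpace F g φ p ⊔ _ = _
    rw [← hR, ← Submodule.map_sup, (L.isCompl_rad_screen p).sup_eq_top, hT]
  · change (tangentImage F φ p ⊓ normalSpace F g φ p) ⊓ _ = _
    rw [← hR, ← Submodule.map_inf _ (L.injective p), (L.isCompl_rad_screen p).inf_eq_bot,
      Submodule.map_bot]

/-- The tangential part, in `T_p M`, of a vector of `T_{φ p} Q` with respect to the decomposition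
`TQ|_M = TM ⊕ tr(TM)`. -/
def tanPart (p : M) : TangentSpace 𝓘(ℝ, E) (φ p) →ₗ[ℝ] TangentSpace 𝓘(ℝ, F) p :=
  (LinearEquiv.ofInjective (mfderiv 𝓘(ℝ, F) 𝓘(ℝ, E) φ p).toLinearMap
      (L.injective p)).symm.toLinearMap ∘ₗ
    Submodule.projectionOnto (tangentImage F φ p) (L.tr p) (L.isCompl_tangent_tr p)

/-- The transversal part of a vector of `T_{φ p} Q`: its component in `tr(TM)`. -/
def trPart (p : M) : TangentSpace 𝓘(ℝ, E) (φ p) →ₗ[ℝ] TangentSpace 𝓘(ℝ, E) (φ p) :=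
  Submodule.projection (L.tr p) (tangentImage F φ p) (L.isCompl_tangent_tr p).symm

/-- The component in `S(TM)` of a tangent vector of `M`. -/
def screenPart (p : M) : TangentSpace 𝓘(ℝ, F) p →ₗ[ℝ] TangentSpace 𝓘(ℝ, F) p :=
  Submodule.projection (L.screen p) (radical F g φ p) (L.isCompl_rad_screen p).symm

/-- The component in `Rad TM` of a tangent vector of `M`. -/
def radPart (p : M) : TangentSpace 𝓘(ℝ, F) p →ₗ[ℝ] TangentSpace 𝓘(ℝ, F) p :=
  Submodule.projection (radical F g φ p) (L.screen p) (L.isCompl_rad_screen p)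

/-- A vector field of `M` as a vector field along `φ`. -/
def push (φ : M → Q) (X : ∀ p : M, TangentSpace 𝓘(ℝ, F) p) (p : M) :
    TangentSpace 𝓘(ℝ, E) (φ p) :=
  mfderiv 𝓘(ℝ, F) 𝓘(ℝ, E) φ p (X p)

section Connection

variable (D : CovariantDerivative 𝓘(ℝ, E) E (TangentSpace 𝓘(ℝ, E) : Q → Type _))

/-- The connection `Ω` induced on `M` by the connection `D` of `Q` (Gauss formula): `Ω_X Y` is the
tangential part of `D_X Y`. -/
def induced (X Y : ∀ p : M, TangentSpace 𝓘(ℝ, F) p) (p : M) : TangentSpace 𝓘(ℝ, F) p :=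
  L.tanPart p (covAlong D φ (push φ Y) p (X p))

/-- The shape operator `A_W X` of a transversal field `W` (Weingarten formula): `-A_W X` is the
tangential part of `D_X W`. -/
def shape (W : ∀ p : M, TangentSpace 𝓘(ℝ, E) (φ p)) (X : ∀ p : M, TangentSpace 𝓘(ℝ, F) p) (p : M) :
    TangentSpace 𝓘(ℝ, F) p :=
  -L.tanPart p (covAlong D φ W p (X p))

/-- `Ω^*_X Y`, for `Y ∈ Γ(S(TM))`: the component of `Ω_X Y` in `S(TM)`. -/
def inducedScreen (X Y : ∀ p : M, TangentSpace 𝓘(ℝ, F) p) (p : M) : TangentSpace 𝓘(ℝ, F) p :=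
  L.screenPart p (L.induced D X Y p)

/-- `h^*(X, Y)`, for `Y ∈ Γ(S(TM))`: the component of `Ω_X Y` in `Rad TM`. -/
def hStar (X Y : ∀ p : M, TangentSpace 𝓘(ℝ, F) p) (p : M) : TangentSpace 𝓘(ℝ, F) p :=
  L.radPart p (L.induced D X Y p)

/-- The distribution `B` on `M` is parallel with respect to the induced connection:
`Ω_Y Z ∈ Γ(B)` for all `Y, Z ∈ Γ(B)`. -/
def IsParallelDistribution (B : ∀ p : M, Submodule ℝ (TangentSpace 𝓘(ℝ, F) p)) : Prop :=
  ∀ Y Z : ∀ p : M, TangentSpace 𝓘(ℝ, F) p, IsSection F id B Y → IsSection F id B Z →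
    ∀ p, L.induced D Y Z p ∈ B p

end Connection

section Bronze

variable (S : BronzeStructure g)

/-- `f X`: the tangential part of `J X`. -/
def f (X : ∀ p : M, TangentSpace 𝓘(ℝ, F) p) (p : M) : TangentSpace 𝓘(ℝ, F) p :=
  L.tanPart p (S.J (φ p) (push φ X p))

/-- `w X`: the transversal part of `J X`. -/
def w (X : ∀ p : M, TangentSpace 𝓘(ℝ, F) p) (p : M) : TangentSpace 𝓘(ℝ, E) (φ p) :=
  L.trPart p (S.J (φ p) (push φ X p))

/-- `B_o = J(S(TM)) ∩ S(TM)`. -/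
def Bo (p : M) : Submodule ℝ (TangentSpace 𝓘(ℝ, F) p) :=
  L.screen p ⊓
    (((L.screen p).map (mfderiv 𝓘(ℝ, F) 𝓘(ℝ, E) φ p).toLinearMap).map
      (S.J (φ p)).toLinearMap).comap (mfderiv 𝓘(ℝ, F) 𝓘(ℝ, E) φ p).toLinearMap

/-- `B'`: the orthogonal complement of `B_o` in `S(TM)`. -/
def Bprime (p : M) : Submodule ℝ (TangentSpace 𝓘(ℝ, F) p) :=
  L.screen p ⊓ ((g.form (φ p)).orthogonal
    ((L.Bo S p).map (mfderiv 𝓘(ℝ, F) 𝓘(ℝ, E) φ p).toLinearMap)).comap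
      (mfderiv 𝓘(ℝ, F) 𝓘(ℝ, E) φ p).toLinearMap

/-- `M` is a screen generic lightlike submanifold: `Rad TM` and the lightlike transversal bundle are
invariant under `J`, and `B_o` is a nondegenerate smooth distribution. -/
structure IsScreenGeneric : Prop where
  rad_invariant : ∀ p, (tangentImage F φ p ⊓ normalSpace F g φ p).map (S.J (φ p)).toLinearMap =
    tangentImage F φ p ⊓ normalSpace F g φ p
  ltr_invariant : ∀ p, (L.ltr p).map (S.J (φ p)).toLinearMap = L.ltr p
  Bo_smooth : IsSmoothSubbundle F id (L.Bo S)
  Bo_nondegenerate : ∀ p, ∀ u ∈ L.Bo S p,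
    (∀ v ∈ L.Bo S p, g.toFun (φ p) (mfderiv 𝓘(ℝ, F) 𝓘(ℝ, E) φ p u)
      (mfderiv 𝓘(ℝ, F) 𝓘(ℝ, E) φ p v) = 0) → u = 0

end Bronze

end LightlikeSubmanifold

end Submanifold

end BronzeLightlike

end

set_option linter.unusedSectionVars false

noncomputable section

namespace BronzeLightlike

open Bundle
open scoped Topology

variable {E : Type*} [NormedAddCommGroup E] [NormedSpace ℝ E] [FiniteDimensional ℝ E]
  {Q : Type*} [TopologicalSpace Q] [ChartedSpace E Q] [IsManifold 𝓘(ℝ, E) ∞ Q]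
  {F : Type*} [NormedAddCommGroup F] [NormedSpace ℝ F] [FiniteDimensional ℝ F]
  {M : Type*} [TopologicalSpace M] [ChartedSpace F M] [IsManifold 𝓘(ℝ, F) ∞ M]

/-! ### Covariant derivatives in a trivialization -/

/-! Self-adjointness of $\bar J$ and $\bar J^2 = 3\bar J + I$ give $\bar g(v,z) = \bar g(\bar
Jv,\bar Jz) - 3\bar g(\bar Jv,z)$ for all $v,z$. Take $v = \bar\nabla_Y Z$; as $\bar\nabla\bar J =
0$, $\bar Jv = \bar\nabla_Y(\bar JZ) = \bar\nabla_Y fZ + \bar\nabla_Y wZ$. The connections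
$\bar\Omega$ and $\bar\nabla$ differ by a multiple of $lY + m\bar JY$, which is invisible to every
$z$ with $Y \perp z, \bar Jz$, so the identity also holds for $\bar\Omega$ with such $z$. This is
`metric_covAlong_eq`.

For $Y \in B'$ it applies to $z \in ltr(TM)$ and to $z \in B_o$: $B'$ is orthogonal to both, and
both are $\bar J$-invariant (the first by hypothesis, the second by `exists_mem_Bo_J`). Since
$tr(TM)$ is orthogonal to $ltr(TM)$ and to $S(TM)$, such $z$ see only the tangential parts of
derivatives. Among tangent vectors, $ltr(TM)$ sees only the radical part and $S(TM)$ only the screen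
part. Hence (i) says $\Omega_YZ \perp N$ and (ii) says $\Omega_YZ \perp X$. By `mem_Bprime_iff`
these orthogonalities together characterize membership in $B'$.

The analytic part justifies the calculus along $\varphi$: `covAlong` is additive and commutes with a
parallel tensor, $fZ$ and $wZ$ are differentiable (`mdiffAlongAt_projection`), and any vector of a
smooth subbundle extends to a global section (`exists_section`), so that conditions on sections
become pointwise. -/

theorem snd_trivialization_eq
    (e : Trivialization E (TotalSpace.proj : TangentBundle 𝓘(ℝ, E) Q → Q)) [e.IsLinear ℝ]
    {x : Q} (hx : x ∈ e.baseSet) (v : TangentSpace 𝓘(ℝ, E) x) :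
    (e ⟨x, v⟩).2 = e.continuousLinearMapAt ℝ x v :=
  (congrFun (e.coe_linearMapAt_of_mem (R := ℝ) hx) v).symm

/-- A section of `TQ` whose expression in the trivialization at `x₀` is differentiable is
differentiable at `x₀`. -/
theorem mdifferentiableAt_symmL_of_mdifferentiableAt (x₀ : Q) {a : Q → E}
    (ha : MDifferentiableAt 𝓘(ℝ, E) 𝓘(ℝ, E) a x₀) :
    MDifferentiableAt 𝓘(ℝ, E) (𝓘(ℝ, E).prod 𝓘(ℝ, E))
      (fun x => (⟨x, (trivializationAt E (TangentSpace 𝓘(ℝ, E) : Q → Type _) x₀).symmL ℝ x (a x)⟩ :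
        TangentBundle 𝓘(ℝ, E) Q)) x₀ := by
  have : IsManifold 𝓘(ℝ, E) 1 Q := IsManifold.of_le (n := ∞) (by simp)
  refine (mdifferentiableAt_section 𝓘(ℝ, E) _).2 (ha.congr_of_eventuallyEq ?_)
  set e := trivializationAt E (TangentSpace 𝓘(ℝ, E) : Q → Type _) x₀
  filter_upwards [e.open_baseSet.mem_nhds (mem_baseSet_trivializationAt E _ x₀)] with x hx
  exact (snd_trivialization_eq e hx _).trans (e.continuousLinearMapAt_symmL hx (a x))

/-- Differentiability of the partial sum is proved together with the formula because the inductive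
step needs it to apply additivity of `D`. -/
theorem cov_finset_sum (D : CovariantDerivative 𝓘(ℝ, E) E (TangentSpace 𝓘(ℝ, E) : Q → Type _))
    {ι : Type*} (s : Finset ι) (σ : ι → ∀ x : Q, TangentSpace 𝓘(ℝ, E) x) (x₀ : Q)
    (hσ : ∀ i, MDifferentiableAt 𝓘(ℝ, E) (𝓘(ℝ, E).prod 𝓘(ℝ, E))
      (fun x => (⟨x, σ i x⟩ : TangentBundle 𝓘(ℝ, E) Q)) x₀) :
    MDifferentiableAt 𝓘(ℝ, E) (𝓘(ℝ, E).prod 𝓘(ℝ, E))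
      (fun x => (⟨x, (∑ i ∈ s, σ i) x⟩ : TangentBundle 𝓘(ℝ, E) Q)) x₀ ∧
    D (∑ i ∈ s, σ i) x₀ = ∑ i ∈ s, D (σ i) x₀ := by
  classical
  have : IsManifold 𝓘(ℝ, E) 1 Q := IsManifold.of_le (n := ∞) (by simp)
  induction s using Finset.induction_on with
  | empty =>
    simp only [Finset.sum_empty]
    refine ⟨mdifferentiableAt_zeroSection ℝ _, ?_⟩
    rw [CovariantDerivative.zero]
    rfl
  | insert i s hi ih =>
    rw [Finset.sum_insert hi, Finset.sum_insert hi]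
    refine ⟨mdifferentiableAt_add_section (hσ i) ih.1, ?_⟩
    rw [D.isCovariantDerivativeOnUniv.add (hσ i) ih.1, ih.2]

/-- The Leibniz rule in the trivialization at `x₀`. -/
theorem cov_symmL (D : CovariantDerivative 𝓘(ℝ, E) E (TangentSpace 𝓘(ℝ, E) : Q → Type _))
    (x₀ : Q) {a : Q → E} (ha : MDifferentiableAt 𝓘(ℝ, E) 𝓘(ℝ, E) a x₀)
    (u : TangentSpace 𝓘(ℝ, E) x₀) :
    let e := trivializationAt E (TangentSpace 𝓘(ℝ, E) : Q → Type _) x₀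
    D (fun x => e.symmL ℝ x (a x)) x₀ u =
      e.symmL ℝ x₀ (mvfderiv 𝓘(ℝ, E) a x₀ u) + D (fun x => e.symmL ℝ x (a x₀)) x₀ u := by
  intro e
  let b := Module.finBasis ℝ E
  let κ : Fin (Module.finrank ℝ E) → E →L[ℝ] ℝ := fun i => LinearMap.toContinuousLinearMap (b.coord i)
  have hκ : ∀ c : E, c = ∑ i, κ i c • b i := fun c => (b.sum_repr c).symm
  have hσ : ∀ i, MDifferentiableAt 𝓘(ℝ, E) (𝓘(ℝ, E).prod 𝓘(ℝ, E))
      (fun x => (⟨x, e.symmL ℝ x (b i)⟩ : TangentBundle 𝓘(ℝ, E) Q)) x₀ := fun i =>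
    mdifferentiableAt_symmL_of_mdifferentiableAt x₀ mdifferentiableAt_const
  -- The scalar Leibniz rule is applied in a basis of `E`. The expansion is used for `a` and for the
  -- constant `a x₀`; the two differ exactly by the derivative term.
  have expand : ∀ a' : Q → E, MDifferentiableAt 𝓘(ℝ, E) 𝓘(ℝ, E) a' x₀ →
      D (fun x => e.symmL ℝ x (a' x)) x₀ u = ∑ i, (κ i (a' x₀) • D (fun x => e.symmL ℝ x (b i)) x₀ u
        + κ i (mvfderiv 𝓘(ℝ, E) a' x₀ u) • e.symmL ℝ x₀ (b i)) := by
    intro a' ha'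
    have hda' : ∀ i, MDifferentiableAt 𝓘(ℝ, E) 𝓘(ℝ, ℝ) (fun x => κ i (a' x)) x₀ := fun i =>
      (κ i).differentiableAt.comp_mdifferentiableAt ha'
    have h1 : (fun x => e.symmL ℝ x (a' x)) =
        ∑ i, (fun x => κ i (a' x)) • (fun x => e.symmL ℝ x (b i)) := by
      funext x
      conv_lhs => rw [hκ (a' x), map_sum]
      rw [Finset.sum_apply]
      exact Finset.sum_congr rfl fun i _ => map_smul _ _ _
    rw [h1, (cov_finset_sum D _ _ x₀ fun i => (hda' i).smul_section (hσ i)).2, sum_apply]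
    refine Finset.sum_congr rfl fun i _ => ?_
    rw [D.isCovariantDerivativeOnUniv.leibniz (hσ i) (hda' i)]
    have h2 : mvfderiv 𝓘(ℝ, E) (fun x => κ i (a' x)) x₀ u = κ i (mvfderiv 𝓘(ℝ, E) a' x₀ u) := by
      have h3 := mfderiv_comp_apply x₀ (g := κ i) (I'' := 𝓘(ℝ, ℝ))
        (κ i).differentiableAt.mdifferentiableAt ha' u
      rw [mfderiv_eq_fderiv, (κ i).fderiv] at h3
      exact h3
    rw [← h2]
    rfl
  rw [expand a ha, expand _ mdifferentiableAt_const, Finset.sum_add_distrib, Finset.sum_add_distrib,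
    mvfderiv_const]
  have h4 : e.symmL ℝ x₀ (mvfderiv 𝓘(ℝ, E) a x₀ u) =
      ∑ i, κ i (mvfderiv 𝓘(ℝ, E) a x₀ u) • e.symmL ℝ x₀ (b i) := by
    conv_lhs => rw [hκ (mvfderiv 𝓘(ℝ, E) a x₀ u), map_sum]
    exact Finset.sum_congr rfl fun i _ => map_smul _ _ _
  rw [h4]
  simp [add_comm]

/-! ### The derivative of sections along a map -/

/-- `V` is differentiable at `p` as a section along `φ` of the tangent bundle. -/
def MDiffAlongAt (F : Type*) [NormedAddCommGroup F] [NormedSpace ℝ F]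
    {M : Type*} [TopologicalSpace M] [ChartedSpace F M]
    (φ : M → Q) (V : ∀ p : M, TangentSpace 𝓘(ℝ, E) (φ p)) (p : M) : Prop :=
  MDifferentiableAt 𝓘(ℝ, F) (𝓘(ℝ, E).prod 𝓘(ℝ, E))
    (fun p => (⟨φ p, V p⟩ : TangentBundle 𝓘(ℝ, E) Q)) p

/-- The expression of a section `V` along `φ` in the trivialization of `TQ` at `φ p`. -/
def coordRep (φ : M → Q) (V : ∀ p : M, TangentSpace 𝓘(ℝ, E) (φ p)) (p y : M) : E :=
  (trivializationAt E (TangentSpace 𝓘(ℝ, E) : Q → Type _) (φ p) ⟨φ y, V y⟩).2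

theorem mdiffAlongAt_iff {φ : M → Q} {V : ∀ p : M, TangentSpace 𝓘(ℝ, E) (φ p)} {p : M} :
    MDiffAlongAt F φ V p ↔ MDifferentiableAt 𝓘(ℝ, F) 𝓘(ℝ, E) φ p ∧
      MDifferentiableAt 𝓘(ℝ, F) 𝓘(ℝ, E) (coordRep φ V p) p := by
  have : IsManifold 𝓘(ℝ, E) 1 Q := IsManifold.of_le (n := ∞) (by simp)
  exact mdifferentiableAt_totalSpace 𝓘(ℝ, E) _

theorem eventually_mem_baseSet {φ : M → Q} {p : M} (hφ : ContinuousAt φ p) :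
    ∀ᶠ y in 𝓝 p, φ y ∈ (trivializationAt E (TangentSpace 𝓘(ℝ, E) : Q → Type _) (φ p)).baseSet :=
  hφ.eventually_mem
    ((trivializationAt E (TangentSpace 𝓘(ℝ, E) : Q → Type _) (φ p)).open_baseSet.mem_nhds
    (mem_baseSet_trivializationAt E _ (φ p)))

theorem coordRep_eq (φ : M → Q) (V : ∀ p : M, TangentSpace 𝓘(ℝ, E) (φ p)) {p y : M}
    (hy : φ y ∈ (trivializationAt E (TangentSpace 𝓘(ℝ, E) : Q → Type _) (φ p)).baseSet) :
    coordRep φ V p y = (trivializationAt E (TangentSpace 𝓘(ℝ, E) : Q → Type _)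
      (φ p)).continuousLinearMapAt ℝ (φ y) (V y) :=
  snd_trivialization_eq _ hy _

theorem symmL_coordRep (φ : M → Q) (V : ∀ p : M, TangentSpace 𝓘(ℝ, E) (φ p)) (p : M) :
    (trivializationAt E (TangentSpace 𝓘(ℝ, E) : Q → Type _) (φ p)).symmL ℝ (φ p)
      (coordRep φ V p p) = V p := by
  have h := mem_baseSet_trivializationAt E (TangentSpace 𝓘(ℝ, E) : Q → Type _) (φ p)
  rw [coordRep_eq φ V h]
  exact Trivialization.symmL_continuousLinearMapAt _ h _

theorem covAlong_eq (D : CovariantDerivative 𝓘(ℝ, E) E (TangentSpace 𝓘(ℝ, E) : Q → Type _))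
    (φ : M → Q) (V : ∀ p : M, TangentSpace 𝓘(ℝ, E) (φ p)) (p : M) (u : TangentSpace 𝓘(ℝ, F) p) :
    let e := trivializationAt E (TangentSpace 𝓘(ℝ, E) : Q → Type _) (φ p)
    covAlong D φ V p u = e.symmL ℝ (φ p) (mvfderiv 𝓘(ℝ, F) (coordRep φ V p) p u) +
      D (fun x => e.symmL ℝ x (coordRep φ V p p)) (φ p) (mfderiv 𝓘(ℝ, F) 𝓘(ℝ, E) φ p u) :=
  rfl

theorem MDiffAlongAt.sub {φ : M → Q} {V W : ∀ p : M, TangentSpace 𝓘(ℝ, E) (φ p)} {p : M}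
    (hV : MDiffAlongAt F φ V p) (hW : MDiffAlongAt F φ W p) :
    MDiffAlongAt F φ (fun y => V y - W y) p := by
  rw [mdiffAlongAt_iff] at *
  refine ⟨hV.1, (hV.2.sub hW.2).congr_of_eventuallyEq ?_⟩
  filter_upwards [eventually_mem_baseSet (E := E) hV.1.continuousAt] with y hy
  rw [Pi.sub_apply, coordRep_eq _ _ hy, coordRep_eq _ _ hy, coordRep_eq _ _ hy, map_sub]

/-- Coordinates are additive only where `φ y` stays in the base set, which suffices for the
derivative at `p`; the constant-coefficient terms add up by additivity of `D`. -/
theorem covAlong_add (D : CovariantDerivative 𝓘(ℝ, E) E (TangentSpace 𝓘(ℝ, E) : Q → Type _))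
    {φ : M → Q} {V W : ∀ p : M, TangentSpace 𝓘(ℝ, E) (φ p)} {p : M}
    (hV : MDiffAlongAt F φ V p) (hW : MDiffAlongAt F φ W p) (u : TangentSpace 𝓘(ℝ, F) p) :
    covAlong D φ (fun y => V y + W y) p u = covAlong D φ V p u + covAlong D φ W p u := by
  rw [mdiffAlongAt_iff] at hV hW
  set e := trivializationAt E (TangentSpace 𝓘(ℝ, E) : Q → Type _) (φ p)
  have h : coordRep φ (fun y => V y + W y) p =ᶠ[𝓝 p] coordRep φ V p + coordRep φ W p := by
    filter_upwards [eventually_mem_baseSet (E := E) hV.1.continuousAt] with y hy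
    rw [Pi.add_apply, coordRep_eq _ _ hy, coordRep_eq _ _ hy, coordRep_eq _ _ hy, map_add]
  have hc : (fun x => e.symmL ℝ x (coordRep φ V p p + coordRep φ W p p)) =
      (fun x => e.symmL ℝ x (coordRep φ V p p)) + fun x => e.symmL ℝ x (coordRep φ W p p) := by
    funext x
    exact map_add _ _ _
  have hd : mvfderiv 𝓘(ℝ, F) (coordRep φ (fun y => V y + W y) p) p u =
      mvfderiv 𝓘(ℝ, F) (coordRep φ V p) p u + mvfderiv 𝓘(ℝ, F) (coordRep φ W p) p u := by
    have h1 : mvfderiv 𝓘(ℝ, F) (coordRep φ (fun y => V y + W y) p) p u =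
        mvfderiv 𝓘(ℝ, F) (coordRep φ V p + coordRep φ W p) p u :=
      congrArg (fun l : F →L[ℝ] E => l u) h.mfderiv_eq
    rw [h1, mvfderiv_add hV.2 hW.2]
    rfl
  rw [covAlong_eq, covAlong_eq, covAlong_eq, hd, h.eq_of_nhds, Pi.add_apply, hc,
    D.isCovariantDerivativeOnUniv.add
      (mdifferentiableAt_symmL_of_mdifferentiableAt (φ p) mdifferentiableAt_const)
      (mdifferentiableAt_symmL_of_mdifferentiableAt (φ p) mdifferentiableAt_const), map_add]
  simp only [add_apply]
  abel

theorem mvfderiv_clm_apply {A : M → E →L[ℝ] E} {v : M → E} {p : M}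
    (hA : MDifferentiableAt 𝓘(ℝ, F) 𝓘(ℝ, E →L[ℝ] E) A p)
    (hv : MDifferentiableAt 𝓘(ℝ, F) 𝓘(ℝ, E) v p) (u : TangentSpace 𝓘(ℝ, F) p) :
    mvfderiv 𝓘(ℝ, F) (fun y => A y (v y)) p u =
      A p (mvfderiv 𝓘(ℝ, F) v p u) + mvfderiv 𝓘(ℝ, F) A p u (v p) := by
  have hAv : HasMFDerivAt 𝓘(ℝ, F) 𝓘(ℝ, (E →L[ℝ] E) × E) (fun y => (A y, v y)) p
      (ContinuousLinearMap.prod (mvfderiv 𝓘(ℝ, F) A p) (mvfderiv 𝓘(ℝ, F) v p)) :=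
    ⟨hA.continuousAt.prodMk hv.continuousAt, hA.hasMFDerivAt.2.prodMk hv.hasMFDerivAt.2⟩
  have h := HasMFDerivAt.comp (I' := 𝓘(ℝ, (E →L[ℝ] E) × E)) p
    (isBoundedBilinearMap_apply.hasFDerivAt (𝕜 := ℝ) (A p, v p)).hasMFDerivAt hAv
  exact congrArg (fun l : F →L[ℝ] E => l u) h.mfderiv

theorem BronzeStructure.mdiffAlongAt {g : SemiRiemannianMetric E Q} (S : BronzeStructure g)
    {φ : M → Q} {V : ∀ p : M, TangentSpace 𝓘(ℝ, E) (φ p)} {p : M} (hV : MDiffAlongAt F φ V p) :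
    MDiffAlongAt F φ (fun y => S.J (φ y) (V y)) p := by
  have : IsManifold 𝓘(ℝ, E) 1 Q := IsManifold.of_le (n := ∞) (by simp)
  have hφ := (mdiffAlongAt_iff.1 hV).1
  have hJ := ((S.smooth.mdifferentiable (by simp)) (φ p)).comp p hφ
  exact MDifferentiableAt.clm_bundle_apply (F₁ := E) (F₂ := E) hJ hV

/-- A parallel endomorphism field commutes with the derivative of sections along a map. -/
theorem BronzeStructure.IsParallelTensor.covAlong {g : SemiRiemannianMetric E Q}
    {S : BronzeStructure g}
    {nabla : CovariantDerivative 𝓘(ℝ, E) E (TangentSpace 𝓘(ℝ, E) : Q → Type _)}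
    (hS : S.IsParallelTensor nabla) {φ : M → Q} {V : ∀ p : M, TangentSpace 𝓘(ℝ, E) (φ p)} {p : M}
    (hV : MDiffAlongAt F φ V p) (u : TangentSpace 𝓘(ℝ, F) p) :
    BronzeLightlike.covAlong nabla φ (fun y => S.J (φ y) (V y)) p u =
      S.J (φ p) (BronzeLightlike.covAlong nabla φ V p u) := by
  have : IsManifold 𝓘(ℝ, E) 1 Q := IsManifold.of_le (n := ∞) (by simp)
  have hJV := S.mdiffAlongAt hV
  rw [mdiffAlongAt_iff] at hV hJV
  set e := trivializationAt E (TangentSpace 𝓘(ℝ, E) : Q → Type _) (φ p) with he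
  have hp : φ p ∈ e.baseSet := mem_baseSet_trivializationAt E _ (φ p)
  -- The tensor `J` as an endomorphism-valued function in the trivialization at `φ p`.
  let 𝒥 : Q → E →L[ℝ] E := fun x => (e.continuousLinearMapAt ℝ x).comp ((S.J x).comp (e.symmL ℝ x))
  have h𝒥 : MDifferentiableAt 𝓘(ℝ, E) 𝓘(ℝ, E →L[ℝ] E) 𝒥 (φ p) :=
    ((mdifferentiableAt_hom_bundle _).1 (S.smooth.mdifferentiable (by simp) (φ p))).2
  have h𝒥e : ∀ x ∈ e.baseSet, ∀ c : E, e.symmL ℝ x (𝒥 x c) = S.J x (e.symmL ℝ x c) :=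
    fun x hx c => e.symmL_continuousLinearMapAt hx _
  set v := coordRep φ V p with hv
  have hrep : coordRep φ (fun y => S.J (φ y) (V y)) p =ᶠ[𝓝 p] fun y => 𝒥 (φ y) (v y) := by
    filter_upwards [eventually_mem_baseSet (E := E) hV.1.continuousAt] with y hy
    rw [coordRep_eq _ _ hy, hv, coordRep_eq _ _ hy]
    change _ = e.continuousLinearMapAt ℝ _ (S.J _ (e.symmL ℝ _ (e.continuousLinearMapAt ℝ _ (V y))))
    rw [e.symmL_continuousLinearMapAt hy]
  set u' := mfderiv 𝓘(ℝ, F) 𝓘(ℝ, E) φ p u with hu'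
  have ha : MDifferentiableAt 𝓘(ℝ, E) 𝓘(ℝ, E) (fun x => 𝒥 x (v p)) (φ p) :=
    h𝒥.clm_apply mdifferentiableAt_const
  -- Product rule and chain rule: one term differentiates `𝒥` with the coordinates frozen at `v p`,
  -- the other differentiates `v`.
  have hd : mvfderiv 𝓘(ℝ, F) (coordRep φ (fun y => S.J (φ y) (V y)) p) p u =
      mvfderiv 𝓘(ℝ, E) (fun x => 𝒥 x (v p)) (φ p) u' + 𝒥 (φ p) (mvfderiv 𝓘(ℝ, F) v p u) := by
    have h1 := mvfderiv_clm_apply (h𝒥.comp p hV.1) hV.2 u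
    have h2 := mvfderiv_clm_apply (p := φ p) h𝒥
      (mdifferentiableAt_const (c := v p) (I := 𝓘(ℝ, E)) (I' := 𝓘(ℝ, E))) u'
    rw [mvfderiv_const] at h2
    have h3 : mvfderiv 𝓘(ℝ, F) (coordRep φ (fun y => S.J (φ y) (V y)) p) p u =
        mvfderiv 𝓘(ℝ, F) (fun y => (𝒥 ∘ φ) y (v y)) p u :=
      congrArg (fun l : F →L[ℝ] E => l u) hrep.mfderiv_eq
    have h4 : mvfderiv 𝓘(ℝ, F) (𝒥 ∘ φ) p u = mvfderiv 𝓘(ℝ, E) 𝒥 (φ p) u' :=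
      mfderiv_comp_apply p h𝒥 hV.1 u
    rw [h3, h1, h2, h4]
    simp [add_comm]
  -- Parallelism is needed only for the field with constant coordinates `v p`; `cov_symmL` then
  -- produces the derivative of `𝒥` that occurs in `hd`.
  have hpar := hS (fun x => e.symmL ℝ x (v p)) (φ p) u'
    (mdifferentiableAt_symmL_of_mdifferentiableAt (φ p) mdifferentiableAt_const)
  have hgerm : nabla (fun x => S.J x (e.symmL ℝ x (v p))) (φ p) =
      nabla (fun x => e.symmL ℝ x (𝒥 x (v p))) (φ p) := by
    refine nabla.isCovariantDerivativeOnUniv.congr_of_eventuallyEq ?_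
      (mdifferentiableAt_symmL_of_mdifferentiableAt (φ p) ha) Filter.univ_mem ?_
    · exact MDifferentiableAt.clm_bundle_apply (F₁ := E) (F₂ := E)
        (S.smooth.mdifferentiable (by simp) (φ p))
        (mdifferentiableAt_symmL_of_mdifferentiableAt (φ p) mdifferentiableAt_const)
    · filter_upwards [e.open_baseSet.mem_nhds hp] with x hx
      exact (h𝒥e x hx _).symm
  rw [covAlong_eq, covAlong_eq, hd, map_add, map_add, ← hpar, hgerm, cov_symmL nabla (φ p) ha,
    h𝒥e _ hp, hrep.eq_of_nhds]
  rw [add_right_comm, add_comm (S.J _ _)]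

/-- The difference of the `(l,m)`-type connection and the Levi-Civita connection, along a map. -/
theorem covAlong_lmConnection {g : SemiRiemannianMetric E Q}
    (nabla : CovariantDerivative 𝓘(ℝ, E) E (TangentSpace 𝓘(ℝ, E) : Q → Type _))
    (S : BronzeStructure g) (D : LMData g) (φ : M → Q) (V : ∀ p : M, TangentSpace 𝓘(ℝ, E) (φ p))
    (p : M) (u : TangentSpace 𝓘(ℝ, F) p) :
    let u' := mfderiv 𝓘(ℝ, F) 𝓘(ℝ, E) φ p u
    covAlong (lmConnection nabla S D) φ V p u = covAlong nabla φ V p u +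
      D.θ (φ p) (V p) • (D.l (φ p) • u' + D.m (φ p) • S.J (φ p) u') := by
  intro u'
  rw [covAlong_eq, covAlong_eq, add_assoc]
  congr 1
  -- The one-form acts on the value at `φ p` of the constant-coordinate extension, and that value is
  -- `V p`.
  rw [← symmL_coordRep φ V p]
  rfl

/-! ### Smooth subbundles along a map -/

theorem SmoothAlong.contMDiffAt {φ : M → Q} {V : ∀ p : M, TangentSpace 𝓘(ℝ, E) (φ p)} {s : Set M}
    (hV : SmoothAlong F φ V s) (hs : IsOpen s) {p : M} (hp : p ∈ s) :
    ContMDiffAt 𝓘(ℝ, F) (𝓘(ℝ, E).prod 𝓘(ℝ, E)) ∞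
      (fun p => (⟨φ p, V p⟩ : TangentBundle 𝓘(ℝ, E) Q)) p :=
  ContMDiffOn.contMDiffAt hV (hs.mem_nhds hp)

theorem SmoothAlong.mdiffAlongAt {φ : M → Q} {V : ∀ p : M, TangentSpace 𝓘(ℝ, E) (φ p)} {s : Set M}
    (hV : SmoothAlong F φ V s) (hs : IsOpen s) {p : M} (hp : p ∈ s) : MDiffAlongAt F φ V p :=
  (hV.contMDiffAt hs hp).mdifferentiableAt (by simp)

theorem contMDiffAt_along_sum_smul {φ : M → Q} {p : M} (hφ : ContMDiffAt 𝓘(ℝ, F) 𝓘(ℝ, E) ∞ φ p)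
    {ι : Type*} [Fintype ι] {a : ι → M → ℝ} {s : ι → ∀ p : M, TangentSpace 𝓘(ℝ, E) (φ p)}
    (ha : ∀ i, ContMDiffAt 𝓘(ℝ, F) 𝓘(ℝ, ℝ) ∞ (a i) p)
    (hs : ∀ i, ContMDiffAt 𝓘(ℝ, F) (𝓘(ℝ, E).prod 𝓘(ℝ, E)) ∞
      (fun p => (⟨φ p, s i p⟩ : TangentBundle 𝓘(ℝ, E) Q)) p) :
    ContMDiffAt 𝓘(ℝ, F) (𝓘(ℝ, E).prod 𝓘(ℝ, E)) ∞
      (fun p => (⟨φ p, ∑ i, a i p • s i p⟩ : TangentBundle 𝓘(ℝ, E) Q)) p := by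
  refine contMDiffAt_totalSpace.2 ⟨hφ, ?_⟩
  have h : ContMDiffAt 𝓘(ℝ, F) 𝓘(ℝ, E) ∞ (fun y => ∑ i, a i y • coordRep φ (s i) p y) p :=
    ContMDiffAt.sum fun i _ => (ha i).smul (contMDiffAt_totalSpace.1 (hs i)).2
  refine h.congr_of_eventuallyEq ?_
  filter_upwards [eventually_mem_baseSet (E := E) hφ.continuousAt] with y hy
  refine (coordRep_eq φ (fun y => ∑ i, a i y • s i y) hy).trans ?_
  rw [map_sum]
  refine Finset.sum_congr rfl fun i _ => ?_
  rw [map_smul, coordRep_eq φ _ hy]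

/-- Every vector of a smooth subbundle is the value of a global section. -/
theorem IsSmoothSubbundle.exists_section [T2Space M] {φ : M → Q}
    (hφ : ContMDiff 𝓘(ℝ, F) 𝓘(ℝ, E) ∞ φ) {D : ∀ p : M, Submodule ℝ (TangentSpace 𝓘(ℝ, E) (φ p))}
    (hD : IsSmoothSubbundle F φ D) {p : M} {v : TangentSpace 𝓘(ℝ, E) (φ p)} (hv : v ∈ D p) :
    ∃ V, IsSection F φ D V ∧ V p = v := by
  obtain ⟨U, hU, hpU, k, s, hs, hspan⟩ := hD p
  obtain ⟨ρ, -, hρ⟩ := (SmoothBumpFunction.nhds_basis_tsupport (I := 𝓘(ℝ, F)) p).mem_iff.1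
    (hU.mem_nhds hpU)
  rw [← (hspan p hpU).2] at hv
  obtain ⟨c, hc⟩ := (Submodule.mem_span_range_iff_exists_fun ℝ).1 hv
  -- The local combination with constant coefficients `c` is cut off by a bump function supported in
  -- `U`; `ρ p = 1` keeps the value `v`.
  refine ⟨fun y => ∑ i, (ρ y * c i) • s i y, ⟨?_, fun y => ?_⟩, ?_⟩
  · rw [SmoothAlong, contMDiffOn_univ]
    intro y
    by_cases hy : y ∈ tsupport ρ
    · exact contMDiffAt_along_sum_smul (hφ y) (a := fun i y => ρ y * c i)
        (fun i => ρ.contMDiffAt.mul contMDiffAt_const)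
        (fun i => (hs i).contMDiffAt hU (hρ hy))
    -- The zero section is written as an empty sum, so that its smoothness is an instance of the
    -- same lemma.
    · have h0 : ContMDiffAt 𝓘(ℝ, F) (𝓘(ℝ, E).prod 𝓘(ℝ, E)) ∞
          (fun p => (⟨φ p, ∑ i : Fin 0, (0 : ℝ) • (0 : TangentSpace 𝓘(ℝ, E) (φ p))⟩ :
            TangentBundle 𝓘(ℝ, E) Q)) y :=
        contMDiffAt_along_sum_smul (hφ y) (ι := Fin 0) (a := fun _ _ => 0) (s := fun _ _ => 0)
          (fun i => i.elim0) (fun i => i.elim0)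
      refine h0.congr_of_eventuallyEq ?_
      filter_upwards [(isClosed_tsupport ρ).isOpen_compl.mem_nhds hy] with z hz
      have hz0 : ρ z = 0 := image_eq_zero_of_notMem_tsupport hz
      simp [hz0]
  · by_cases hy : y ∈ tsupport ρ
    · rw [← (hspan y (hρ hy)).2]
      exact Submodule.sum_mem _ fun i _ => Submodule.smul_mem _ _ (Submodule.subset_span ⟨i, rfl⟩)
    · have hy0 : ρ y = 0 := image_eq_zero_of_notMem_tsupport hy
      simp [hy0]
  · simp [← hc]

/-- The sum of two smooth subbundles which are pointwise disjoint is a smooth subbundle. -/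
theorem IsSmoothSubbundle.sup {φ : M → Q}
    {D₁ D₂ : ∀ p : M, Submodule ℝ (TangentSpace 𝓘(ℝ, E) (φ p))}
    (h₁ : IsSmoothSubbundle F φ D₁) (h₂ : IsSmoothSubbundle F φ D₂)
    (hd : ∀ p, Disjoint (D₁ p) (D₂ p)) : IsSmoothSubbundle F φ (fun p => D₁ p ⊔ D₂ p) := by
  intro p
  obtain ⟨U, hU, hpU, k, s, hs, hspan⟩ := h₁ p
  obtain ⟨U', hU', hpU', k', s', hs', hspan'⟩ := h₂ p
  have hfun : ∀ y, (fun i => Sum.elim s s' (finSumFinEquiv.symm i) y) =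
      Sum.elim (fun j => s j y) (fun j => s' j y) ∘ finSumFinEquiv.symm := fun y => by
    funext i
    simp only [Function.comp_apply]
    rcases finSumFinEquiv.symm i with j | j <;> rfl
  refine ⟨U ∩ U', hU.inter hU', ⟨hpU, hpU'⟩, k + k',
    fun i => Sum.elim s s' (finSumFinEquiv.symm i), fun i => ?_, fun y hy => ?_⟩
  · rcases h : finSumFinEquiv.symm i with j | j
    · simp only [h]
      exact (show ContMDiffOn _ _ _ _ _ from hs j).mono Set.inter_subset_left
    · simp only [h]
      exact (show ContMDiffOn _ _ _ _ _ from hs' j).mono Set.inter_subset_right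
  · rw [hfun y]
    refine ⟨LinearIndependent.comp (LinearIndependent.sum_type (hspan y hy.1).1
      (hspan' y hy.2).1 ?_) finSumFinEquiv.symm finSumFinEquiv.symm.injective, ?_⟩
    · rw [(hspan y hy.1).2, (hspan' y hy.2).2]
      exact hd y
    · rw [finSumFinEquiv.symm.surjective.range_comp, Set.Sum.elim_range, Submodule.span_union,
        (hspan y hy.1).2, (hspan' y hy.2).2]

theorem SmoothAlong.push {φ : M → Q} (hφ : ContMDiff 𝓘(ℝ, F) 𝓘(ℝ, E) ∞ φ)
    {X : ∀ p : M, TangentSpace 𝓘(ℝ, F) p} {s : Set M} (hX : SmoothAlong F id X s) :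
    SmoothAlong F φ (LightlikeSubmanifold.push (E := E) φ X) s := by
  have h := (ContMDiff.contMDiff_tangentMap (I := 𝓘(ℝ, F)) (I' := 𝓘(ℝ, E)) (m := ∞) hφ
    (by simp)).comp_contMDiffOn hX
  exact h

theorem IsSmoothSubbundle.map_mfderiv {φ : M → Q} (hφ : ContMDiff 𝓘(ℝ, F) 𝓘(ℝ, E) ∞ φ)
    (hinj : ∀ p, Function.Injective (mfderiv 𝓘(ℝ, F) 𝓘(ℝ, E) φ p))
    {D : ∀ p : M, Submodule ℝ (TangentSpace 𝓘(ℝ, F) p)} (hD : IsSmoothSubbundle F id D) :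
    IsSmoothSubbundle F φ
      (fun p => (D p).map (mfderiv 𝓘(ℝ, F) 𝓘(ℝ, E) φ p).toLinearMap) := by
  intro p
  obtain ⟨U, hU, hpU, k, s, hs, hspan⟩ := hD p
  refine ⟨U, hU, hpU, k, fun i => LightlikeSubmanifold.push (E := E) φ (s i),
    fun i => SmoothAlong.push hφ (hs i), fun y hy => ⟨?_, ?_⟩⟩
  · exact (hspan y hy).1.map' (mfderiv 𝓘(ℝ, F) 𝓘(ℝ, E) φ y).toLinearMap
      (LinearMap.ker_eq_bot.2 (hinj y))
  · have h := congrArg (Submodule.map (mfderiv 𝓘(ℝ, F) 𝓘(ℝ, E) φ y).toLinearMap) (hspan y hy).2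
    rw [Submodule.map_span, ← Set.range_comp] at h
    exact h

/-- The frame map of two frames of subbundles along `φ`, in the trivialization at `φ p`. -/
def frameMap (φ : M → Q) {k k' : ℕ} (s : Fin k → ∀ p : M, TangentSpace 𝓘(ℝ, E) (φ p))
    (t : Fin k' → ∀ p : M, TangentSpace 𝓘(ℝ, E) (φ p)) (p y : M) :
    ((Fin k → ℝ) × (Fin k' → ℝ)) →L[ℝ] E :=
  ∑ i, ((ContinuousLinearMap.proj i).comp (ContinuousLinearMap.fst ℝ _ _)).smulRight
      (coordRep φ (s i) p y) +
    ∑ j, ((ContinuousLinearMap.proj j).comp (ContinuousLinearMap.snd ℝ _ _)).smulRight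
      (coordRep φ (t j) p y)

theorem frameMap_apply {φ : M → Q} {k k' : ℕ} (s : Fin k → ∀ p : M, TangentSpace 𝓘(ℝ, E) (φ p))
    (t : Fin k' → ∀ p : M, TangentSpace 𝓘(ℝ, E) (φ p)) {p y : M}
    (hy : φ y ∈ (trivializationAt E (TangentSpace 𝓘(ℝ, E) : Q → Type _) (φ p)).baseSet)
    (c : (Fin k → ℝ) × (Fin k' → ℝ)) :
    frameMap φ s t p y c = (trivializationAt E (TangentSpace 𝓘(ℝ, E) : Q → Type _)
      (φ p)).continuousLinearMapAt ℝ (φ y) (∑ i, c.1 i • s i y + ∑ j, c.2 j • t j y) := by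
  simp only [frameMap, map_add, map_sum, map_smul, add_apply, sum_apply, coordRep_eq φ _ hy]
  rfl

/-- The projection onto one of two complementary smooth subbundles preserves differentiability. -/
theorem IsSmoothSubbundle.mdiffAlongAt_projection {φ : M → Q}
    {T N : ∀ p : M, Submodule ℝ (TangentSpace 𝓘(ℝ, E) (φ p))}
    (hT : IsSmoothSubbundle F φ T) (hN : IsSmoothSubbundle F φ N) (hTN : ∀ p, IsCompl (T p) (N p))
    {V W : ∀ p : M, TangentSpace 𝓘(ℝ, E) (φ p)} (hW : ∀ p, W p ∈ N p)
    (hVW : ∀ p, V p - W p ∈ T p) {p : M} (hV : MDiffAlongAt F φ V p) : MDiffAlongAt F φ W p := by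
  obtain ⟨U, hU, hpU, k, s, hs, hspan⟩ := hT p
  obtain ⟨U', hU', hpU', k', t, ht, hspan'⟩ := hN p
  rw [mdiffAlongAt_iff] at hV ⊢
  refine ⟨hV.1, ?_⟩
  set e := trivializationAt E (TangentSpace 𝓘(ℝ, E) : Q → Type _) (φ p) with he
  have hbase := eventually_mem_baseSet (E := E) hV.1.continuousAt
  have hev : ∀ᶠ y in 𝓝 p, y ∈ U ∧ y ∈ U' ∧ φ y ∈ e.baseSet :=
    (hU.eventually_mem hpU).and ((hU'.eventually_mem hpU').and hbase)
  -- `A y` sends frame coefficients to coordinates of the vector. The projection onto `N` is `A y`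
  -- after dropping the `T`-coefficients of `(A y)⁻¹`, and inversion is differentiable at invertible
  -- maps.
  let A := frameMap φ s t p
  have hA : MDifferentiableAt 𝓘(ℝ, F) 𝓘(ℝ, ((Fin k → ℝ) × (Fin k' → ℝ)) →L[ℝ] E) A p := by
    have h : ∀ (n : ℕ) (s : Fin n → ∀ p : M, TangentSpace 𝓘(ℝ, E) (φ p)) (U : Set M), IsOpen U →
        p ∈ U → (∀ i, SmoothAlong F φ (s i) U) →
        ∀ c : Fin n → (((Fin k → ℝ) × (Fin k' → ℝ)) →L[ℝ] ℝ),
        MDifferentiableAt 𝓘(ℝ, F) 𝓘(ℝ, ((Fin k → ℝ) × (Fin k' → ℝ)) →L[ℝ] E)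
          (fun y => ∑ i, (c i).smulRight (coordRep φ (s i) p y)) p := by
      intro n s U hU hpU hs c
      refine ContMDiffAt.mdifferentiableAt (n := 1) (ContMDiffAt.sum fun i _ => ?_) (by simp)
      exact (ContinuousLinearMap.smulRightL ℝ ((Fin k → ℝ) × (Fin k' → ℝ)) E
        (c i)).contDiff.contDiffAt.contMDiffAt.comp p
        ((contMDiffAt_totalSpace.1 ((hs i).contMDiffAt hU hpU)).2.of_le (by simp))
    exact (h k s U hU hpU hs _).add (h k' t U' hU' hpU' ht _)
  have hbij : ∀ y, y ∈ U → y ∈ U' → φ y ∈ e.baseSet → Function.Bijective (A y) := by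
    intro y hy hy' hyb
    have hs_mem : ∀ c : Fin k → ℝ, ∑ i, c i • s i y ∈ T y := fun c => by
      rw [← (hspan y hy).2]
      exact Submodule.sum_mem _ fun i _ => Submodule.smul_mem _ _ (Submodule.subset_span ⟨i, rfl⟩)
    have ht_mem : ∀ d : Fin k' → ℝ, ∑ i, d i • t i y ∈ N y := fun d => by
      rw [← (hspan' y hy').2]
      exact Submodule.sum_mem _ fun i _ => Submodule.smul_mem _ _ (Submodule.subset_span ⟨i, rfl⟩)
    constructor
    · rw [injective_iff_map_eq_zero]
      rintro ⟨c, d⟩ hcd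
      rw [frameMap_apply s t hyb] at hcd
      have h0 := congrArg (e.symmL ℝ (φ y)) hcd
      rw [e.symmL_continuousLinearMapAt hyb, map_zero] at h0
      have h1 : ∑ i, c i • s i y = 0 := by
        refine Submodule.disjoint_def.1 (hTN y).disjoint _ (hs_mem c) ?_
        rw [eq_neg_of_add_eq_zero_left h0]
        exact neg_mem (ht_mem d)
      have h2 : ∑ i, d i • t i y = 0 := by
        simpa only [h1, zero_add] using h0
      ext i
      · exact Fintype.linearIndependent_iff.1 (hspan y hy).1 c h1 i
      · exact Fintype.linearIndependent_iff.1 (hspan' y hy').1 d h2 i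
    · intro v
      have hv : e.symmL ℝ (φ y) v ∈ T y ⊔ N y := by
        rw [(hTN y).sup_eq_top]
        trivial
      obtain ⟨v₁, h₁, v₂, h₂, hv⟩ := Submodule.mem_sup.1 hv
      rw [← (hspan y hy).2] at h₁
      rw [← (hspan' y hy').2] at h₂
      obtain ⟨c, hc⟩ := (Submodule.mem_span_range_iff_exists_fun ℝ).1 h₁
      obtain ⟨d, hd⟩ := (Submodule.mem_span_range_iff_exists_fun ℝ).1 h₂
      refine ⟨(c, d), ?_⟩
      rw [frameMap_apply s t hyb, hc, hd, hv, e.continuousLinearMapAt_symmL hyb]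
  have hequiv : ∀ y, y ∈ U → y ∈ U' → φ y ∈ e.baseSet →
      ∃ Φ : ((Fin k → ℝ) × (Fin k' → ℝ)) ≃L[ℝ] E, (Φ : _ →L[ℝ] E) = A y :=
    fun y hy hy' hyb => ⟨(LinearEquiv.ofBijective (A y).toLinearMap
      (hbij y hy hy' hyb)).toContinuousLinearEquiv, by ext <;> rfl⟩
  have hinv : ∀ᶠ y in 𝓝 p, ∀ c, (A y).inverse (A y c) = c := by
    filter_upwards [hev] with y hy c
    obtain ⟨Φ, hΦ⟩ := hequiv y hy.1 hy.2.1 hy.2.2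
    rw [← hΦ, ContinuousLinearMap.inverse_equiv]
    exact Φ.symm_apply_apply c
  have hAi : MDifferentiableAt 𝓘(ℝ, F) 𝓘(ℝ, E →L[ℝ] ((Fin k → ℝ) × (Fin k' → ℝ)))
      (fun y => (A y).inverse) p := by
    obtain ⟨Φ, hΦ⟩ := hequiv p hpU hpU' hev.self_of_nhds.2.2
    have h := (contDiffAt_map_inverse (𝕜 := ℝ) (n := 1) Φ).differentiableAt (by simp)
    rw [hΦ] at h
    exact h.comp_mdifferentiableAt hA
  have hmain : MDifferentiableAt 𝓘(ℝ, F) 𝓘(ℝ, E) (fun y => A y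
      (((ContinuousLinearMap.inr ℝ (Fin k → ℝ) (Fin k' → ℝ)).comp (ContinuousLinearMap.snd ℝ _ _))
        ((A y).inverse (coordRep φ V p y)))) p :=
    hA.clm_apply ((ContinuousLinearMap.differentiableAt _).comp_mdifferentiableAt
      (hAi.clm_apply hV.2))
  refine hmain.congr_of_eventuallyEq ?_
  filter_upwards [hev, hinv] with y hy hiy
  have h1 := hVW y
  have h2 := hW y
  rw [← (hspan y hy.1).2] at h1
  rw [← (hspan' y hy.2.1).2] at h2
  obtain ⟨c, hc⟩ := (Submodule.mem_span_range_iff_exists_fun ℝ).1 h1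
  obtain ⟨d, hd⟩ := (Submodule.mem_span_range_iff_exists_fun ℝ).1 h2
  have h3 : coordRep φ V p y = A y (c, d) := by
    rw [coordRep_eq φ V hy.2.2, frameMap_apply s t hy.2.2, hc, hd, sub_add_cancel]
  have h4 : coordRep φ W p y = A y (0, d) := by
    rw [coordRep_eq φ W hy.2.2, frameMap_apply s t hy.2.2, hd]
    simp
  rw [h3, h4, hiy]
  rfl

/-! ### The bundles of a lightlike submanifold -/

namespace LightlikeSubmanifold

variable {g : SemiRiemannianMetric E Q} {φ : M → Q} {r : ℕ} (L : LightlikeSubmanifold F g φ r)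

theorem tanPart_add_trPart (p : M) (v : TangentSpace 𝓘(ℝ, E) (φ p)) :
    mfderiv 𝓘(ℝ, F) 𝓘(ℝ, E) φ p (L.tanPart p v) + L.trPart p v = v := by
  have h : mfderiv 𝓘(ℝ, F) 𝓘(ℝ, E) φ p (L.tanPart p v) =
      (tangentImage F φ p).projectionOnto (L.tr p) (L.isCompl_tangent_tr p) v :=
    congrArg Subtype.val ((LinearEquiv.ofInjective (mfderiv 𝓘(ℝ, F) 𝓘(ℝ, E) φ p).toLinearMap
      (L.injective p)).apply_symm_apply _)
  rw [h]
  exact Submodule.projection_add_projection_eq_self (L.isCompl_tangent_tr p) v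

theorem trPart_mem (p : M) (v : TangentSpace 𝓘(ℝ, E) (φ p)) : L.trPart p v ∈ L.tr p :=
  Submodule.projection_apply_mem _ _

theorem radPart_mem (p : M) (x : TangentSpace 𝓘(ℝ, F) p) : L.radPart p x ∈ radical F g φ p :=
  Submodule.projection_apply_mem _ _

theorem screenPart_mem (p : M) (x : TangentSpace 𝓘(ℝ, F) p) : L.screenPart p x ∈ L.screen p :=
  Submodule.projection_apply_mem _ _

theorem radPart_add_screenPart (p : M) (x : TangentSpace 𝓘(ℝ, F) p) :
    L.radPart p x + L.screenPart p x = x :=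
  Submodule.projection_add_projection_eq_self (L.isCompl_rad_screen p) x

/-! ### Orthogonality relations between the bundles -/

theorem metric_radical {p : M} {ξ : TangentSpace 𝓘(ℝ, F) p} (hξ : ξ ∈ radical F g φ p)
    (x : TangentSpace 𝓘(ℝ, F) p) :
    g.toFun (φ p) (mfderiv 𝓘(ℝ, F) 𝓘(ℝ, E) φ p ξ) (mfderiv 𝓘(ℝ, F) 𝓘(ℝ, E) φ p x) = 0 := by
  rw [g.symm]
  exact hξ _ ⟨x, rfl⟩

theorem metric_screenTr {p : M} {w : TangentSpace 𝓘(ℝ, E) (φ p)} (hw : w ∈ L.screenTr p)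
    (x : TangentSpace 𝓘(ℝ, F) p) :
    g.toFun (φ p) (mfderiv 𝓘(ℝ, F) 𝓘(ℝ, E) φ p x) w = 0 := by
  have h : w ∈ normalSpace F g φ p := L.rad_sup_screenTr p ▸ Submodule.mem_sup_right hw
  exact h _ ⟨x, rfl⟩

theorem metric_screen_ltr {p : M} {n : TangentSpace 𝓘(ℝ, E) (φ p)} (hn : n ∈ L.ltr p)
    {x : TangentSpace 𝓘(ℝ, F) p} (hx : x ∈ L.screen p) :
    g.toFun (φ p) (mfderiv 𝓘(ℝ, F) 𝓘(ℝ, E) φ p x) n = 0 := by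
  have h := (L.rad_sup_ltr p).le (Submodule.mem_sup_right hn)
  exact h.1 _ ⟨x, hx, rfl⟩

theorem metric_tr_ltr {p : M} {n t : TangentSpace 𝓘(ℝ, E) (φ p)} (hn : n ∈ L.ltr p)
    (ht : t ∈ L.tr p) : g.toFun (φ p) t n = 0 := by
  obtain ⟨n', hn', w, hw, rfl⟩ := Submodule.mem_sup.1 ht
  have h : g.toFun (φ p) w n = 0 := ((L.rad_sup_ltr p).le (Submodule.mem_sup_right hn)).2 w hw
  rw [map_add, add_apply, L.ltr_null p n' hn' n hn, h, add_zero]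

theorem metric_tr_screen {p : M} {t : TangentSpace 𝓘(ℝ, E) (φ p)} (ht : t ∈ L.tr p)
    {x : TangentSpace 𝓘(ℝ, F) p} (hx : x ∈ L.screen p) :
    g.toFun (φ p) t (mfderiv 𝓘(ℝ, F) 𝓘(ℝ, E) φ p x) = 0 := by
  obtain ⟨n, hn, w, hw, rfl⟩ := Submodule.mem_sup.1 ht
  rw [map_add, add_apply, g.symm _ n, g.symm _ w, L.metric_screen_ltr hn hx, L.metric_screenTr hw,
    add_zero]

/-- Pairing with `ltr(TM)` only sees the tangential part. -/
theorem metric_tanPart_ltr {p : M} {n : TangentSpace 𝓘(ℝ, E) (φ p)} (hn : n ∈ L.ltr p)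
    (v : TangentSpace 𝓘(ℝ, E) (φ p)) :
    g.toFun (φ p) (mfderiv 𝓘(ℝ, F) 𝓘(ℝ, E) φ p (L.tanPart p v)) n = g.toFun (φ p) v n := by
  conv_rhs => rw [← L.tanPart_add_trPart p v]
  rw [map_add, add_apply, L.metric_tr_ltr hn (L.trPart_mem p v), add_zero]

/-- Pairing with `ltr(TM)` only sees the radical part of a tangent vector. -/
theorem metric_radPart_ltr {p : M} {n : TangentSpace 𝓘(ℝ, E) (φ p)} (hn : n ∈ L.ltr p)
    (x : TangentSpace 𝓘(ℝ, F) p) :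
    g.toFun (φ p) (mfderiv 𝓘(ℝ, F) 𝓘(ℝ, E) φ p (L.radPart p x)) n =
      g.toFun (φ p) (mfderiv 𝓘(ℝ, F) 𝓘(ℝ, E) φ p x) n := by
  conv_rhs => rw [← L.radPart_add_screenPart p x]
  rw [map_add, map_add, add_apply, L.metric_screen_ltr hn (L.screenPart_mem p x), add_zero]

/-- Pairing with `S(TM)` only sees the tangential part. -/
theorem metric_tanPart_screen {p : M} {x : TangentSpace 𝓘(ℝ, F) p} (hx : x ∈ L.screen p)
    (v : TangentSpace 𝓘(ℝ, E) (φ p)) :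
    g.toFun (φ p) (mfderiv 𝓘(ℝ, F) 𝓘(ℝ, E) φ p (L.tanPart p v))
      (mfderiv 𝓘(ℝ, F) 𝓘(ℝ, E) φ p x) = g.toFun (φ p) v (mfderiv 𝓘(ℝ, F) 𝓘(ℝ, E) φ p x) := by
  conv_rhs => rw [← L.tanPart_add_trPart p v]
  rw [map_add, add_apply, L.metric_tr_screen (L.trPart_mem p v) hx, add_zero]

/-- Pairing with a tangent vector only sees the screen part of a tangent vector. -/
theorem metric_screenPart {p : M} (x y : TangentSpace 𝓘(ℝ, F) p) :
    g.toFun (φ p) (mfderiv 𝓘(ℝ, F) 𝓘(ℝ, E) φ p (L.screenPart p x))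
      (mfderiv 𝓘(ℝ, F) 𝓘(ℝ, E) φ p y) =
      g.toFun (φ p) (mfderiv 𝓘(ℝ, F) 𝓘(ℝ, E) φ p x) (mfderiv 𝓘(ℝ, F) 𝓘(ℝ, E) φ p y) := by
  conv_rhs => rw [← L.radPart_add_screenPart p x]
  rw [map_add, map_add, add_apply, metric_radical (L.radPart_mem p x), zero_add]

/-- A tangent vector orthogonal to `ltr(TM)` lies in `S(TM)`. -/
theorem mem_screen_of_metric_ltr {p : M} {x : TangentSpace 𝓘(ℝ, F) p}
    (hx : ∀ n ∈ L.ltr p, g.toFun (φ p) (mfderiv 𝓘(ℝ, F) 𝓘(ℝ, E) φ p x) n = 0) :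
    x ∈ L.screen p := by
  -- The radical part is orthogonal to $TM$ and $S(TM^\perp)$, and by `hx` to $ltr(TM)$, hence to
  -- everything.
  have h0 : mfderiv 𝓘(ℝ, F) 𝓘(ℝ, E) φ p (L.radPart p x) = 0 := by
    refine g.nondegenerate _ _ fun v => ?_
    obtain ⟨n, hn, w, hw, h⟩ := Submodule.mem_sup.1 (L.trPart_mem p v)
    rw [← L.tanPart_add_trPart p v, ← h, map_add, map_add, metric_radical (L.radPart_mem p x),
      L.metric_radPart_ltr hn, hx n hn, L.metric_screenTr hw, add_zero, add_zero]
  have h1 : L.radPart p x = 0 := L.injective p (h0.trans (map_zero _).symm)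
  rw [← L.radPart_add_screenPart p x, h1, zero_add]
  exact L.screenPart_mem p x

/-! ### Pairings with the bronze structure -/

section Bronze

variable (S : BronzeStructure g)

/-- Orthogonality to $ltr(TM)$ replaces membership in $S(TM)$, so that lying in $B'$ becomes a
system of vanishing pairings. -/
theorem mem_Bprime_iff {p : M} {x : TangentSpace 𝓘(ℝ, F) p} :
    x ∈ L.Bprime S p ↔
      (∀ n ∈ L.ltr p, g.toFun (φ p) (mfderiv 𝓘(ℝ, F) 𝓘(ℝ, E) φ p x) n = 0) ∧
      ∀ y ∈ L.Bo S p, g.toFun (φ p) (mfderiv 𝓘(ℝ, F) 𝓘(ℝ, E) φ p x)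
        (mfderiv 𝓘(ℝ, F) 𝓘(ℝ, E) φ p y) = 0 := by
  constructor
  · rintro ⟨hx, hx'⟩
    refine ⟨fun n hn => L.metric_screen_ltr hn hx, fun y hy => ?_⟩
    rw [g.symm]
    exact hx' _ ⟨y, hy, rfl⟩
  · rintro ⟨h1, h2⟩
    refine ⟨L.mem_screen_of_metric_ltr h1, ?_⟩
    rintro _ ⟨y, hy, rfl⟩
    exact (g.symm _ _ _).trans (h2 y hy)

/-- `B_o` is invariant under `J`. -/
theorem exists_mem_Bo_J {p : M} {x : TangentSpace 𝓘(ℝ, F) p} (hx : x ∈ L.Bo S p) :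
    ∃ y ∈ L.Bo S p, mfderiv 𝓘(ℝ, F) 𝓘(ℝ, E) φ p y =
      S.J (φ p) (mfderiv 𝓘(ℝ, F) 𝓘(ℝ, E) φ p x) := by
  obtain ⟨hxs, _, ⟨s, hs, rfl⟩, h⟩ := hx
  have h' : S.J (φ p) (mfderiv 𝓘(ℝ, F) 𝓘(ℝ, E) φ p s) = mfderiv 𝓘(ℝ, F) 𝓘(ℝ, E) φ p x := h
  -- With $x = \bar Js$ one gets $\bar Jx = 3\bar Js + s = 3x + s$, which lies in $S(TM)$.
  have hy : mfderiv 𝓘(ℝ, F) 𝓘(ℝ, E) φ p ((3 : ℝ) • x + s) =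
      S.J (φ p) (mfderiv 𝓘(ℝ, F) 𝓘(ℝ, E) φ p x) := by
    rw [map_add, map_smul, ← h', S.sq]
  refine ⟨(3 : ℝ) • x + s, ⟨add_mem (Submodule.smul_mem _ _ hxs) hs,
    ⟨_, ⟨x, hxs, rfl⟩, hy.symm⟩⟩, hy⟩

theorem isSmoothSubbundle_tangentImage (L : LightlikeSubmanifold F g φ r) :
    IsSmoothSubbundle F φ (tangentImage (E := E) F φ) := by
  have h := (L.rad_smooth.sup L.screen_smooth fun p => (L.isCompl_rad_screen p).disjoint).map_mfderiv
    L.smooth L.injective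
  convert h using 2 with p
  rw [(L.isCompl_rad_screen p).sup_eq_top, Submodule.map_top]
  rfl

/-- A vector common to $ltr(TM)$ and $S(TM^\perp)$ is orthogonal to $TM$, to $ltr(TM)$ and to
$S(TM^\perp)$, so it is zero and the sum is direct. -/
theorem isSmoothSubbundle_tr : IsSmoothSubbundle F φ L.tr := by
  refine L.ltr_smooth.sup L.screenTr_smooth fun p => Submodule.disjoint_def.2 fun v hv hv' => ?_
  refine g.nondegenerate _ _ fun u => ?_
  obtain ⟨n, hn, w, hw, h⟩ := Submodule.mem_sup.1 (L.trPart_mem p u)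
  rw [← L.tanPart_add_trPart p u, ← h, map_add, map_add, g.symm, L.metric_screenTr hv', g.symm _ v w,
    L.ltr_null p v hv n hn, L.metric_tr_ltr hv (Submodule.mem_sup_right hw), add_zero, add_zero]

variable {S}

/-- The tangential and the transversal part of `JZ` are differentiable. -/
theorem mdiffAlongAt_w {Z : ∀ p : M, TangentSpace 𝓘(ℝ, F) p}
    (hZ : SmoothAlong F id Z Set.univ) (p : M) :
    MDiffAlongAt F φ (push (E := E) φ (L.f S Z)) p ∧ MDiffAlongAt F φ (L.w S Z) p := by
  have hJ : MDiffAlongAt F φ (fun y => S.J (φ y) (push (E := E) φ Z y)) p :=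
    S.mdiffAlongAt ((SmoothAlong.push L.smooth hZ).mdiffAlongAt isOpen_univ (Set.mem_univ p))
  have hf : ∀ y, push (E := E) φ (L.f S Z) y = S.J (φ y) (push φ Z y) - L.w S Z y := fun y =>
    eq_sub_of_add_eq (L.tanPart_add_trPart y (S.J (φ y) (push φ Z y)))
  have hw : MDiffAlongAt F φ (L.w S Z) p :=
    L.isSmoothSubbundle_tangentImage.mdiffAlongAt_projection L.isSmoothSubbundle_tr
      L.isCompl_tangent_tr (fun y => L.trPart_mem y _) (fun y => ⟨L.f S Z y, hf y⟩) hJ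
  refine ⟨?_, hw⟩
  rw [funext hf]
  exact hJ.sub hw

/-- Let `z` be such that `z` and `J z` are orthogonal to `Y`. Then `g(Ω̄_Y Z, z)` is determined by
the derivatives of the tangential and of the transversal part of `J Z`. -/
theorem metric_covAlong_eq
    {nabla : CovariantDerivative 𝓘(ℝ, E) E (TangentSpace 𝓘(ℝ, E) : Q → Type _)}
    (hS : S.IsParallelTensor nabla) (D : LMData g) {Z : ∀ p : M, TangentSpace 𝓘(ℝ, F) p}
    (hZ : SmoothAlong F id Z Set.univ) {p : M} (u : TangentSpace 𝓘(ℝ, F) p)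
    (z : TangentSpace 𝓘(ℝ, E) (φ p))
    (hz : g.toFun (φ p) (mfderiv 𝓘(ℝ, F) 𝓘(ℝ, E) φ p u) z = 0)
    (hJz : g.toFun (φ p) (mfderiv 𝓘(ℝ, F) 𝓘(ℝ, E) φ p u) (S.J (φ p) z) = 0) :
    g.toFun (φ p) (covAlong (lmConnection nabla S D) φ (push φ Z) p u) z =
      g.toFun (φ p) (covAlong (lmConnection nabla S D) φ (push φ (L.f S Z)) p u) (S.J (φ p) z) +
      g.toFun (φ p) (covAlong (lmConnection nabla S D) φ (L.w S Z) p u) (S.J (φ p) z) -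
      3 * (g.toFun (φ p) (covAlong (lmConnection nabla S D) φ (push φ (L.f S Z)) p u) z +
        g.toFun (φ p) (covAlong (lmConnection nabla S D) φ (L.w S Z) p u) z) := by
  have hsum : (fun y => push φ (L.f S Z) y + L.w S Z y) = fun y => S.J (φ y) (push φ Z y) :=
    funext fun y => L.tanPart_add_trPart y (S.J (φ y) (push φ Z y))
  have hadd := covAlong_add (lmConnection nabla S D) (L.mdiffAlongAt_w (S := S) hZ p).1
    (L.mdiffAlongAt_w (S := S) hZ p).2 u
  rw [hsum] at hadd
  -- The connections are compared against both `z` and `J z`, and the latter requires `J (J z)` to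
  -- be orthogonal to `u` as well.
  have hJJz : g.toFun (φ p) (mfderiv 𝓘(ℝ, F) 𝓘(ℝ, E) φ p u) (S.J (φ p) (S.J (φ p) z)) = 0 := by
    rw [S.sq, map_add, map_smul, hz, hJz, smul_zero, add_zero]
  -- Self-adjointness moves `J` from `u` to `z'`, so both terms of the difference of the connections
  -- pair to zero.
  have hlm : ∀ (V : ∀ p : M, TangentSpace 𝓘(ℝ, E) (φ p)) (z' : TangentSpace 𝓘(ℝ, E) (φ p)),
      g.toFun (φ p) (mfderiv 𝓘(ℝ, F) 𝓘(ℝ, E) φ p u) z' = 0 →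
      g.toFun (φ p) (mfderiv 𝓘(ℝ, F) 𝓘(ℝ, E) φ p u) (S.J (φ p) z') = 0 →
      g.toFun (φ p) (covAlong (lmConnection nabla S D) φ V p u) z' =
        g.toFun (φ p) (covAlong nabla φ V p u) z' := by
    intro V z' h1 h2
    rw [covAlong_lmConnection]
    simp only [map_add, map_smul, add_apply, smul_apply, ← S.compatible, h1, h2, smul_zero,
      add_zero]
  have hpar := hS.covAlong (V := push φ Z) (p := p)
    ((SmoothAlong.push L.smooth hZ).mdiffAlongAt isOpen_univ (Set.mem_univ p)) u
  rw [← add_apply, ← map_add, ← add_apply, ← map_add, ← hadd, hlm _ _ hz hJz, hlm _ _ hz hJz,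
    hlm _ _ hJz hJJz, hpar, ← S.compatible, ← S.compatible, S.sq, map_add, map_smul, smul_eq_mul]
  ring

/-- `Ω_Y Z` is orthogonal to `N ∈ ltr(TM)` if and only if the first identity holds for `N`. -/
theorem metric_induced_ltr_eq_zero_iff
    {nabla : CovariantDerivative 𝓘(ℝ, E) E (TangentSpace 𝓘(ℝ, E) : Q → Type _)}
    (hS : S.IsParallelTensor nabla) (D : LMData g) (hL : L.IsScreenGeneric S)
    {Y Z : ∀ p : M, TangentSpace 𝓘(ℝ, F) p} {p : M} {n : TangentSpace 𝓘(ℝ, E) (φ p)}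
    (hY : IsSection F id (L.Bprime S) Y) (hZ : IsSection F id (L.Bprime S) Z)
    (hn : n ∈ L.ltr p) :
    g.toFun (φ p) (mfderiv 𝓘(ℝ, F) 𝓘(ℝ, E) φ p (L.induced (lmConnection nabla S D) Y Z p)) n = 0 ↔
      g.toFun (φ p) (mfderiv 𝓘(ℝ, F) 𝓘(ℝ, E) φ p
          (L.hStar (lmConnection nabla S D) Y (L.f S Z) p)) (S.J (φ p) n) +
        3 * g.toFun (φ p) (mfderiv 𝓘(ℝ, F) 𝓘(ℝ, E) φ p
          (L.shape (lmConnection nabla S D) (L.w S Z) Y p)) n =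
      3 * g.toFun (φ p) (mfderiv 𝓘(ℝ, F) 𝓘(ℝ, E) φ p
          (L.hStar (lmConnection nabla S D) Y (L.f S Z) p)) n +
        g.toFun (φ p) (mfderiv 𝓘(ℝ, F) 𝓘(ℝ, E) φ p
          (L.shape (lmConnection nabla S D) (L.w S Z) Y p)) (S.J (φ p) n) := by
  have hJn : S.J (φ p) n ∈ L.ltr p := (hL.ltr_invariant p).le ⟨n, hn, rfl⟩
  have hYn := ((L.mem_Bprime_iff S).1 (hY.2 p)).1
  have h := L.metric_covAlong_eq hS D hZ.1 (Y p) n (hYn n hn) (hYn _ hJn)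
  -- Everything reduces to pairings of full derivatives with `n` and `J n`; the sign of the shape
  -- operator accounts for the sides on which its terms stand.
  simp only [hStar, shape, L.metric_radPart_ltr hn,
    L.metric_radPart_ltr hJn, induced, map_neg, neg_apply,
    L.metric_tanPart_ltr hn, L.metric_tanPart_ltr hJn, h]
  constructor <;> intro h' <;> linarith

/-- `Ω_Y Z` is orthogonal to `X ∈ B_o` if and only if the second identity holds for `X`. -/
theorem metric_induced_Bo_eq_zero_iff
    {nabla : CovariantDerivative 𝓘(ℝ, E) E (TangentSpace 𝓘(ℝ, E) : Q → Type _)}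
    (hS : S.IsParallelTensor nabla) (D : LMData g)
    {Y Z : ∀ p : M, TangentSpace 𝓘(ℝ, F) p} {p : M} {x : TangentSpace 𝓘(ℝ, F) p}
    (hY : IsSection F id (L.Bprime S) Y) (hZ : IsSection F id (L.Bprime S) Z)
    (hx : x ∈ L.Bo S p) :
    g.toFun (φ p) (mfderiv 𝓘(ℝ, F) 𝓘(ℝ, E) φ p (L.induced (lmConnection nabla S D) Y Z p))
        (mfderiv 𝓘(ℝ, F) 𝓘(ℝ, E) φ p x) = 0 ↔
      g.toFun (φ p) (mfderiv 𝓘(ℝ, F) 𝓘(ℝ, E) φ p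
          (L.inducedScreen (lmConnection nabla S D) Y (L.f S Z) p))
          (S.J (φ p) (mfderiv 𝓘(ℝ, F) 𝓘(ℝ, E) φ p x)) +
        3 * g.toFun (φ p) (mfderiv 𝓘(ℝ, F) 𝓘(ℝ, E) φ p
          (L.shape (lmConnection nabla S D) (L.w S Z) Y p)) (mfderiv 𝓘(ℝ, F) 𝓘(ℝ, E) φ p x) =
      g.toFun (φ p) (mfderiv 𝓘(ℝ, F) 𝓘(ℝ, E) φ p
          (L.shape (lmConnection nabla S D) (L.w S Z) Y p))
          (S.J (φ p) (mfderiv 𝓘(ℝ, F) 𝓘(ℝ, E) φ p x)) +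
        3 * g.toFun (φ p) (mfderiv 𝓘(ℝ, F) 𝓘(ℝ, E) φ p
          (L.inducedScreen (lmConnection nabla S D) Y (L.f S Z) p))
          (mfderiv 𝓘(ℝ, F) 𝓘(ℝ, E) φ p x) := by
  obtain ⟨y, hy, hyx⟩ := L.exists_mem_Bo_J S hx
  have hYx := ((L.mem_Bprime_iff S).1 (hY.2 p)).2
  have h := L.metric_covAlong_eq hS D hZ.1 (Y p) (mfderiv 𝓘(ℝ, F) 𝓘(ℝ, E) φ p x) (hYx x hx)
    (hyx ▸ hYx y hy)
  -- Writing $\bar JX$ as the image of `y` in $B_o$ makes it a screen vector, so the pairing lemmas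
  -- apply to it too.
  rw [← hyx] at h ⊢
  simp only [inducedScreen, shape, L.metric_screenPart,
    induced, map_neg, neg_apply,
    L.metric_tanPart_screen hx.1, L.metric_tanPart_screen hy.1, h]
  constructor <;> intro h' <;> linarith

end Bronze

end LightlikeSubmanifold

end BronzeLightlike

end

/-! ### The equivalence -/

theorem mainTheorem8
    {E : Type*} [NormedAddCommGroup E] [NormedSpace ℝ E] [FiniteDimensional ℝ E]
    {Q : Type*} [TopologicalSpace Q] [T2Space Q] [SigmaCompactSpace Q] [ChartedSpace E Q]
    [IsManifold 𝓘(ℝ, E) ∞ Q]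
    {F : Type*} [NormedAddCommGroup F] [NormedSpace ℝ F] [FiniteDimensional ℝ F]
    {M : Type*} [TopologicalSpace M] [T2Space M] [SigmaCompactSpace M] [ChartedSpace F M]
    [IsManifold 𝓘(ℝ, F) ∞ M]
    -- the locally bronze semi-Riemannian manifold `(Q, g, J)` with an `(l,m)`-type connection
    (g : BronzeLightlike.SemiRiemannianMetric E Q)
    (nabla : CovariantDerivative 𝓘(ℝ, E) E (TangentSpace 𝓘(ℝ, E) : Q → Type _))
    (hnabla : BronzeLightlike.IsLeviCivita g nabla)
    (S : BronzeLightlike.BronzeStructure g) (hS : S.IsParallelTensor nabla)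
    (D : BronzeLightlike.LMData g)
    -- the screen generic lightlike submanifold `φ : M → Q`
    (φ : M → Q) (r : ℕ) (L : BronzeLightlike.LightlikeSubmanifold F g φ r)
    (hL : L.IsScreenGeneric S) :
    L.IsParallelDistribution (BronzeLightlike.lmConnection nabla S D) (L.Bprime S) ↔
      (∀ (Y Z : ∀ p : M, TangentSpace 𝓘(ℝ, F) p) (N : ∀ p : M, TangentSpace 𝓘(ℝ, E) (φ p)),
        BronzeLightlike.IsSection F id (L.Bprime S) Y →
        BronzeLightlike.IsSection F id (L.Bprime S) Z →
        BronzeLightlike.IsSection F φ L.ltr N →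
        ∀ p : M,
          let gp := g.toFun (φ p)
          let J := S.J (φ p)
          let dφ := mfderiv 𝓘(ℝ, F) 𝓘(ℝ, E) φ p
          let h := dφ (L.hStar (BronzeLightlike.lmConnection nabla S D) Y (L.f S Z) p)
          let A := dφ (L.shape (BronzeLightlike.lmConnection nabla S D) (L.w S Z) Y p)
          gp h (J (N p)) + 3 * gp A (N p) = 3 * gp h (N p) + gp A (J (N p))) ∧
      (∀ Y Z X : ∀ p : M, TangentSpace 𝓘(ℝ, F) p,
        BronzeLightlike.IsSection F id (L.Bprime S) Y →
        BronzeLightlike.IsSection F id (L.Bprime S) Z →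
        BronzeLightlike.IsSection F id (L.Bo S) X →
        ∀ p : M,
          let gp := g.toFun (φ p)
          let J := S.J (φ p)
          let dφ := mfderiv 𝓘(ℝ, F) 𝓘(ℝ, E) φ p
          let Ωs := dφ (L.inducedScreen (BronzeLightlike.lmConnection nabla S D) Y (L.f S Z) p)
          let A := dφ (L.shape (BronzeLightlike.lmConnection nabla S D) (L.w S Z) Y p)
          gp Ωs (J (dφ (X p))) + 3 * gp A (dφ (X p)) =
            gp A (J (dφ (X p))) + 3 * gp Ωs (dφ (X p))) := by
  constructor
  · intro hpar
    exact ⟨fun Y Z N hY hZ hN p => (L.metric_induced_ltr_eq_zero_iff hS D hL hY hZ (hN.2 p)).1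
        (((L.mem_Bprime_iff S).1 (hpar Y Z hY hZ p)).1 _ (hN.2 p)),
      fun Y Z X hY hZ hX p => (L.metric_induced_Bo_eq_zero_iff hS D hY hZ (hX.2 p)).1
        (((L.mem_Bprime_iff S).1 (hpar Y Z hY hZ p)).2 _ (hX.2 p))⟩
  · rintro ⟨h1, h2⟩ Y Z hY hZ p
    refine (L.mem_Bprime_iff S).2 ⟨fun n hn => ?_, fun x hx => ?_⟩
    -- The hypotheses concern global sections, so the given vector is extended to one.
    · obtain ⟨N, hN, rfl⟩ := L.ltr_smooth.exists_section L.smooth hn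
      exact (L.metric_induced_ltr_eq_zero_iff hS D hL hY hZ hn).2 (h1 Y Z N hY hZ hN p)
    · obtain ⟨X, hX, rfl⟩ := hL.Bo_smooth.exists_section contMDiff_id hx
      exact (L.metric_induced_Bo_eq_zero_iff hS D hY hZ hx).2 (h2 Y Z X hY hZ hX p)
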